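/- **Setting.** Let $\mathbb X,\mathbb Y$ be non-empty locally compact Polish spaces with locally finite positive Borel measures $\lambda,\nu$. Let $U:\mathbb X\to\mathbb R$, $V:\mathbb Y\to\mathbb R$, $W:\mathbb X\times\mathbb Y\to\mathbb R$ be measurable, such that $\lambda_U(dx):=e^{-U(x)}\lambda(dx)$ and $\nu_V(dy):=e^{-V(y)}\nu(dy)$ are probability measures and $\mathcal Q(x,dy):=e^{-W(x,y)}\nu(dy)$ is a Markov transition. The Sinkhorn transitions are $\mathcal S_0:=\mathcal Q$ and, for $n\ge 0$, $$\pi_{2n}:=\lambda_U\mathcal S_{2n},\qquad \pi_{2n}(dy)\,\mathcal S_{2n+1}(y,dx)=\lambda_U(dx)\,\mathcal S_{2n}(x,dy),$$ $$\pi_{2n+1}:=\nu_V\mathcal S_{2n+1},\qquad \pi_{2n+1}(dx)\,\mathcal S_{2n+2}(x,dy)=\nu_V(dy)\,\mathcal S_{2n+1}(y,dx),$$ and $\mathcal P_{2n}(d(x,y)):=\lambda_U(dx)\,\mathcal S_{2n}(x,dy)$. The Schrödinger bridge is $\mathbb P:=\arg\min \mathrm{Ent}(\mathcal P\,|\,\mathcal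 P_0)$ over the couplings $\mathcal P$ of $\lambda_U$ and $\nu_V$, where $\mathrm{Ent}$ is relative entropy. Put $W^V(x):=\int W(x,y)\,\nu_V(dy)$ and $W_U(y):=\int W(x,y)\,\lambda_U(dx)$, and for $\delta>0$ $$\mathcal U_{\delta/2}:=\tfrac{\delta}{2}U-W^V,\qquad \mathcal V_{\delta/2}:=\tfrac{\delta}{2}V-W_U .$$ For a positive function $\varphi$ and probability measures $\mu_1,\mu_2$ on the same space, with $\Pi(\mu_1,\mu_2)$ the set of their couplings, $$|||\mu_1-\mu_2|||_\varphi:=\inf_{\mathcal P\in\Pi(\mu_1,\mu_2)}\int(\varphi(x_1)+\varphi(x_2))\,1_{x_1\ne x_2}\,d\mathcal P,\qquad \mathbb W_\varrho(\mu_1,\mu_2):=\inf_{\mathcal P\in\Pi(\mu_1,\mu_2)}\int\varrho(x_1,x_2)\,d\mathcal P,$$ for a measurable semi-metric $\varrho\geq 0$ (symmetric and zero on the diagonal). Further, $\|\mu_1-\mu_2\|_{tv}:=\sup_A|\mu_1(A)-\mu_2(A)|$, and $\|f\|_\varphi$ is the (essential) supremum of $|f|/\varphi$. A function is called locally bounded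 if it is bounded on compact sets. **Theorem.** Assume that $W$ is locally bounded and bounded from below, that $U,V$ are locally bounded with compact sub-level sets, that $W(x,\cdot)$ is $\nu_V$-integrable for every $x$ and $W(\cdot,y)$ is $\lambda_U$-integrable for every $y$, and that for some $\delta\in\,]0,1[$ the functions $\mathcal U_{\delta/2}$ and $\mathcal V_{\delta/2}$ are locally bounded with compact sub-level sets and $$\lambda_{(1-\delta)U}(1)=\int e^{-(1-\delta)U}d\lambda<\infty\quad\text{and}\quad \nu_{(1-\delta)V}(1)=\int e^{-(1-\delta)V}d\nu<\infty .$$ Set $\varphi:=e^{\delta U/2}$ and $\psi:=e^{\delta V/2}$. Then there exist $\rho\in\,]0,1[$, $n_0\ge1$ and $c>0$ such that: 1. For all $n\ge n_0$, $\pi_{2n}$ and $\nu_V$ are mutually absolutely continuous, $$|||\pi_{2n}-\nu_V|||_\psi\le c\rho^n,\qquad \Big\|\log\frac{d\pi_{2n}}{d\nu_V}\Big\|_\psi\le c\rho^n,\qquad \|\pi_{2n}-\nu_V\|_{tv}\le c\rho^n,$$ and $\mathbb W_\varrho(\pi_{2n},\nu_V)\le c\rho^n$ for every semi-metric $\varrho$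 on $\mathbb Y$ with $\varrho(y_1,y_2)\le\psi(y_1)+\psi(y_2)$ for all $y_1,y_2$. 2. For all $n\ge n_0$, $\pi_{2n+1}$ and $\lambda_U$ are mutually absolutely continuous, $$|||\pi_{2n+1}-\lambda_U|||_\varphi\le c\rho^n,\qquad \Big\|\log\frac{d\pi_{2n+1}}{d\lambda_U}\Big\|_\varphi\le c\rho^n,\qquad \|\pi_{2n+1}-\lambda_U\|_{tv}\le c\rho^n,$$ and $\mathbb W_\varrho(\pi_{2n+1},\lambda_U)\le c\rho^n$ for every semi-metric $\varrho$ on $\mathbb X$ with $\varrho(x_1,x_2)\le\varphi(x_1)+\varphi(x_2)$ for all $x_1,x_2$. 3. The Schrödinger bridge $\mathbb P$ exists and is unique, and $\mathrm{Ent}(\mathbb P\,|\,\mathcal P_{2n})\le c\rho^n$ for all $n\ge0$. -/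

import Mathlib

open MeasureTheory ProbabilityTheory Set
open scoped ENNReal

namespace Sinkhorn

noncomputable section

/-- Bounded on every compact set. -/
def LocallyBdd {E : Type*} [TopologicalSpace E] (f : E → ℝ) : Prop :=
  ∀ K : Set E, IsCompact K → ∃ C : ℝ, ∀ x ∈ K, |f x| ≤ C

/-- All sub-level sets `{f ≤ r}` are compact. -/
def CompactSublevels {E : Type*} [TopologicalSpace E] (f : E → ℝ) : Prop :=
  ∀ r : ℝ, IsCompact {x | f x ≤ r}

/-- The measure `m_F(dx) = e^{-F(x)} m(dx)`. -/
def gibbs {E : Type*} [MeasurableSpace E] (m : Measure E) (F : E → ℝ) : Measure E :=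
  m.withDensity fun x => ENNReal.ofReal (Real.exp (-F x))

section Model

variable {X Y : Type*} [MeasurableSpace X] [MeasurableSpace Y]

/-- The reference transition `Q(x,dy) = e^{-W(x,y)} ν(dy)` (for jointly measurable `W`). -/
def refKernel (W : X → Y → ℝ) (nu : Measure Y) [SFinite nu] : Kernel X Y :=
  Kernel.withDensity (Kernel.const X nu) fun x y => ENNReal.ofReal (Real.exp (-W x y))

/-- `W^V(x) = ∫ W(x,y) η(dy)`, where `η` is the second marginal. -/
def costX (W : X → Y → ℝ) (eta : Measure Y) (x : X) : ℝ := ∫ y, W x y ∂eta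

/-- `W_U(y) = ∫ W(x,y) μ(dx)`, where `μ` is the first marginal. -/
def costY (W : X → Y → ℝ) (mu : Measure X) (y : Y) : ℝ := ∫ x, W x y ∂mu

section Iteration

variable [StandardBorelSpace X] [Nonempty X] [StandardBorelSpace Y] [Nonempty Y]

/-- The Sinkhorn transitions `S_{2n}` with first marginal `μ`, second marginal `η` and `S_0 = Q`,
bundled with the Markov property. Here `κ†μ` is the conditional law of the first coordinate given
the second one under `μ × κ`, so that `S_{2n+1} = S_{2n}†μ` and `S_{2n+2} = S_{2n+1}†η`, that is
`(π_{2n} × S_{2n+1})^♭ = μ × S_{2n}` and `π_{2n+1} × S_{2n+2} = (η × S_{2n+1})^♭`. -/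
def evenAux (mu : Measure X) [IsProbabilityMeasure mu] (eta : Measure Y) [IsProbabilityMeasure eta]
    (Q : Kernel X Y) [hQ : IsMarkovKernel Q] : ℕ → {S : Kernel X Y // IsMarkovKernel S}
  | 0 => ⟨Q, hQ⟩
  | n + 1 =>
    haveI : IsMarkovKernel (evenAux mu eta Q n).1 := (evenAux mu eta Q n).2
    ⟨((evenAux mu eta Q n).1†mu)†eta, inferInstance⟩

variable (mu : Measure X) [IsProbabilityMeasure mu] (eta : Measure Y) [IsProbabilityMeasure eta]
  (Q : Kernel X Y) [IsMarkovKernel Q]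

/-- The transition `S_{2n}` from `X` to `Y`. -/
def evenKernel (n : ℕ) : Kernel X Y := (evenAux mu eta Q n).1

instance (n : ℕ) : IsMarkovKernel (evenKernel mu eta Q n) := (evenAux mu eta Q n).2

/-- The transition `S_{2n+1}` from `Y` to `X`. -/
def oddKernel (n : ℕ) : Kernel Y X := (evenKernel mu eta Q n)†mu

/-- The marginal `π_{2n} = μ S_{2n}` on `Y`. -/
def evenMarginal (n : ℕ) : Measure Y := (evenKernel mu eta Q n) ∘ₘ mu

/-- The marginal `π_{2n+1} = η S_{2n+1}` on `X`. -/
def oddMarginal (n : ℕ) : Measure X := (oddKernel mu eta Q n) ∘ₘ eta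

/-- The Sinkhorn bridge `P_{2n} = μ × S_{2n}` on `X × Y`. -/
def evenBridge (n : ℕ) : Measure (X × Y) := mu ⊗ₘ (evenKernel mu eta Q n)

end Iteration

/-- Measures on the product with prescribed first and second marginals. -/
def couplings (mu : Measure X) (eta : Measure Y) : Set (Measure (X × Y)) :=
  {P | P.map Prod.fst = mu ∧ P.map Prod.snd = eta}

/-- `P` minimizes the relative entropy `Ent(· | R)` among the couplings of `μ` and `η`. -/
def IsSchrodingerBridge (mu : Measure X) (eta : Measure Y) (R P : Measure (X × Y)) : Prop :=
  P ∈ couplings mu eta ∧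
    ∀ P' ∈ couplings mu eta, InformationTheory.klDiv P R ≤ InformationTheory.klDiv P' R

end Model

section Distances

variable {E : Type*} [MeasurableSpace E]

/-- The weighted total variation distance: the infimum over the couplings of `m₁` and `m₂` of
`∫ (φ(x₁) + φ(x₂)) 1_{x₁ ≠ x₂} dP`. -/
def weightedDist (φ : E → ℝ) (m₁ m₂ : Measure E) : ℝ≥0∞ :=
  ⨅ P ∈ couplings m₁ m₂, ∫⁻ z in {z : E × E | z.1 ≠ z.2}, ENNReal.ofReal (φ z.1 + φ z.2) ∂P

/-- The Wasserstein semi-metric: the infimum over the couplings of `m₁` and `m₂` of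
`∫ ϱ(x₁,x₂) dP`. -/
def wasserstein (rho : E → E → ℝ) (m₁ m₂ : Measure E) : ℝ≥0∞ :=
  ⨅ P ∈ couplings m₁ m₂, ∫⁻ z, ENNReal.ofReal (rho z.1 z.2) ∂P

/-- Total variation distance between probability measures, `sup_A |m₁(A) - m₂(A)|`. -/
def tvDist (m₁ m₂ : Measure E) : ℝ≥0∞ :=
  ⨆ (A : Set E) (_ : MeasurableSet A), ENNReal.ofReal |m₁.real A - m₂.real A|

/-- The weighted supremum norm `‖f‖_φ = ‖f/φ‖`, for functions defined up to `m`-null sets. -/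
def weightedSupNorm (m : Measure E) (φ f : E → ℝ) : ℝ≥0∞ :=
  eLpNorm (fun x => f x / φ x) ⊤ m

end Distances

/-- A semi-metric: nonnegative, symmetric and zero on the diagonal. Neither the triangle inequality
nor separation of points is required, so that every usual convention is covered. -/
structure IsSemiMetric {E : Type*} (rho : E → E → ℝ) : Prop where
  nonneg : ∀ x y, 0 ≤ rho x y
  self : ∀ x, rho x x = 0
  symm : ∀ x y, rho x y = rho y x

end

end Sinkhorn

namespace Sinkhorn

/-! ### Weights, integrated costs and bands of scaling functions -/

section Admissible

variable {X Y : Type*}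

/-! With `μ = λ_U`, `η = ν_V`, each Sinkhorn bridge has the form `a_n(x) e^{-W(x,y)} b_n(y)` with
respect to `μ ⊗ η`. It starts from `a_0 = 1`, `b_0 = e^V`, and each update replaces one factor by
the reciprocal of an integral of the other against `e^{-W}` (`scaling`). The marginals then have
densities `b_n / b_{n+1}` and `a_n / a_{n+1}`, so everything reduces to the sequences `potX`,
`potY`.

Uniform bounds (`Admissible.exists_bands`): Jensen's inequality gives `a_n ≤ exp(-∫ log b_n dη)
e^{W^V}`, and symmetrically for `b_{n+1}`. Since the marginal densities integrate to one, Jensen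
also shows that `∫ log b_n dη` and `∫ log a_n dμ` are nondecreasing, so these prefactors never
exceed their initial values. As `W` is bounded below, the upper bounds yield constant lower bounds
for the next factors.

Contraction (`Admissible.contraction`): compactness of the sub-level sets of `𝒰_{δ/2}` makes
`e^{W^V}` negligible against `φ` at infinity. With `∫ ψ² dη < ∞` this is a drift condition for the
transition densities `a e^{-W} b`, and boundedness of `W` on products of sub-level sets of `φ`, `ψ`
is a minorization. Hence these transitions contract centred functions in `L¹` norms with weights `1
+ βφ`, `1 + βψ`, uniformly in `n`. Applied to `1 - a_n/a_{n+1}`, the contraction gives geometric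
decay of the marginal errors (`Admissible.geometric`).

Integrating against the bounded kernel turns `L¹` decay into pointwise decay of the log increments,
so the factors converge to a solution `(a, b)` of the Schrödinger system
(`Admissible.exists_fixedPoint`). The log density of `a e^{-W} b` with respect to any iterate is a
function of `x` plus a function of `y`, whose integral is the same under every coupling. The
Pythagorean identity for relative entropy then identifies `a e^{-W} b` as the unique bridge and
writes its entropy relative to an iterate as an integral of log differences. The distances between
marginals are bounded with a maximal coupling. -/

/-- The exponential of the integrated cost `∫ W(x,y) η(dy)`. -/
noncomputable def expCost [MeasurableSpace Y] (W : X → Y → ℝ) (eta : Measure Y) (x : X) : ℝ :=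
  Real.exp (costX W eta x)

theorem expCost_pos [MeasurableSpace Y] (W : X → Y → ℝ) (eta : Measure Y) (x : X) :
    0 < expCost W eta x :=
  Real.exp_pos _

variable [MeasurableSpace X] [MeasurableSpace Y]

/-- A cost `W` bounded below, with weights `φ`, `ψ` that are square integrable, dominate the
exponentials of the integrated costs, and have sub-level sets on which `W` is bounded. -/
structure Admissible (mu : Measure X) (eta : Measure Y) (W : X → Y → ℝ) (φ : X → ℝ)
    (ψ : Y → ℝ) : Prop where
  measurable_cost : Measurable (Function.uncurry W)
  bddBelow : ∃ w, ∀ x y, w ≤ W x y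
  integrable_left : ∀ x, Integrable (fun y => W x y) eta
  integrable_right : ∀ y, Integrable (fun x => W x y) mu
  measurable_left : Measurable φ
  measurable_right : Measurable ψ
  lower_left : ∃ c > 0, ∀ x, c ≤ φ x
  lower_right : ∃ c > 0, ∀ y, c ≤ ψ y
  sq_left : Integrable (fun x => φ x ^ 2) mu
  sq_right : Integrable (fun y => ψ y ^ 2) eta
  dom_left : ∀ ε > 0, ∃ C, ∀ x, expCost W eta x ≤ ε * φ x + C
  dom_right : ∀ ε > 0, ∃ C, ∀ y, expCost (flip W) mu y ≤ ε * ψ y + C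
  bdd_sublevel : ∀ r, ∃ C, ∀ x y, φ x ≤ r → ψ y ≤ r → W x y ≤ C

namespace Admissible

variable {mu : Measure X} {eta : Measure Y} {W : X → Y → ℝ} {φ : X → ℝ} {ψ : Y → ℝ}

/-- Every estimate is proved for one variable only and transferred to the other through this
symmetry. -/
theorem swap (H : Admissible mu eta W φ ψ) : Admissible eta mu (flip W) ψ φ where
  measurable_cost := H.measurable_cost.comp measurable_swap
  bddBelow := H.bddBelow.imp fun _ h y x => h x y
  integrable_left := H.integrable_right
  integrable_right := H.integrable_left
  measurable_left := H.measurable_right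
  measurable_right := H.measurable_left
  lower_left := H.lower_right
  lower_right := H.lower_left
  sq_left := H.sq_right
  sq_right := H.sq_left
  dom_left := H.dom_right
  dom_right := H.dom_left
  bdd_sublevel r := (H.bdd_sublevel r).imp fun _ h y x hy hx => h x y hx hy

variable (H : Admissible mu eta W φ ψ)
include H

theorem left_pos (x : X) : 0 < φ x := by
  obtain ⟨c, hc, h⟩ := H.lower_left
  exact hc.trans_le (h x)

theorem right_pos (y : Y) : 0 < ψ y := H.swap.left_pos y

theorem integrable_phi [IsProbabilityMeasure mu] : Integrable φ mu := by
  refine ((integrable_const (1 : ℝ)).add H.sq_left).mono' H.measurable_left.aestronglyMeasurable ?_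
  filter_upwards with x
  have := H.left_pos x
  simp only [Pi.add_apply, Real.norm_eq_abs, abs_of_pos this]
  nlinarith [sq_nonneg (φ x - 1)]

theorem integrable_psi [IsProbabilityMeasure eta] : Integrable ψ eta := H.swap.integrable_phi

theorem exists_kernel_le : ∃ M > 0, ∀ x y, Real.exp (-W x y) ≤ M := by
  obtain ⟨w, hw⟩ := H.bddBelow
  exact ⟨Real.exp (-w), Real.exp_pos _, fun x y => Real.exp_le_exp.2 (by linarith [hw x y])⟩

theorem measurable_kernel : Measurable (fun z : X × Y => Real.exp (-W z.1 z.2)) :=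
  (H.measurable_cost.neg).exp

theorem measurable_expCost [SFinite eta] : Measurable (expCost W eta) :=
  (H.measurable_cost.stronglyMeasurable.integral_prod_right (ν := eta)).measurable.exp

/-- The additive constant in the domination is absorbed because `φ` is bounded away from zero. -/
theorem exists_expCost_le : ∃ C > 0, ∀ x, expCost W eta x ≤ C * φ x := by
  obtain ⟨c, hc, h⟩ := H.lower_left
  obtain ⟨C, hC⟩ := H.dom_left 1 one_pos
  refine ⟨1 + |C| / c, by positivity, fun x => (hC x).trans ?_⟩
  have : |C| ≤ |C| / c * φ x := by
    rw [div_mul_eq_mul_div, le_div_iff₀ hc]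
    exact mul_le_mul_of_nonneg_left (h x) (abs_nonneg _)
  linarith [le_abs_self C]

theorem integrable_expCost [IsProbabilityMeasure mu] [SFinite eta] :
    Integrable (expCost W eta) mu := by
  obtain ⟨C, -, hC⟩ := H.exists_expCost_le
  refine (H.integrable_phi.const_mul C).mono' H.measurable_expCost.aestronglyMeasurable ?_
  filter_upwards with x
  rw [Real.norm_eq_abs, abs_of_pos (expCost_pos W eta x)]
  exact hC x

end Admissible

/-- Measurable functions between the constant `c` and `C G`. -/
structure Band (G : X → ℝ) (c C : ℝ) (a : X → ℝ) : Prop where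
  meas : Measurable a
  lower : ∀ x, c ≤ a x
  upper : ∀ x, a x ≤ C * G x

namespace Band

variable {mu : Measure X} {eta : Measure Y} {W : X → Y → ℝ} {φ : X → ℝ} {ψ : Y → ℝ}
  {G : X → ℝ} {c C : ℝ} {a : X → ℝ}

theorem pos (h : Band G c C a) (hc : 0 < c) (x : X) : 0 < a x := hc.trans_le (h.lower x)

theorem mono {c' C' : ℝ} (h : Band G c C a) (hG : ∀ x, 0 ≤ G x) (hc : c' ≤ c) (hC : C ≤ C') :
    Band G c' C' a :=
  ⟨h.meas, fun x => hc.trans (h.lower x),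
    fun x => (h.upper x).trans (mul_le_mul_of_nonneg_right hC (hG x))⟩

theorem integrable (h : Band G c C a) (hc : 0 < c) (hG : Integrable G mu) : Integrable a mu := by
  refine (hG.const_mul C).mono' h.meas.aestronglyMeasurable ?_
  filter_upwards with x
  rw [Real.norm_eq_abs, abs_of_pos (h.pos hc x)]
  exact h.upper x

/-- From above `log a ≤ a - 1`, from below `log a ≥ log c`. -/
theorem integrable_log [IsProbabilityMeasure mu] (h : Band G c C a) (hc : 0 < c)
    (hG : Integrable G mu) : Integrable (fun x => Real.log (a x)) mu := by
  refine ((integrable_const |Real.log c|).add (h.integrable hc hG)).mono'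
    h.meas.log.aestronglyMeasurable ?_
  filter_upwards with x
  have h1 := Real.log_le_sub_one_of_pos (h.pos hc x)
  have h2 := Real.log_le_log hc (h.lower x)
  have h3 := h.pos hc x
  simp only [Pi.add_apply, Real.norm_eq_abs]
  rw [abs_le]
  constructor <;> linarith [neg_abs_le (Real.log c), abs_nonneg (Real.log c)]

end Band

end Admissible

/-! ### Drift, minorization and contraction in weighted `L¹` norms -/

section Contraction

variable {X Y : Type*} [MeasurableSpace X] [MeasurableSpace Y]

/-- The sub-level sets exhaust the space, so they cannot all be null. -/
theorem exists_pos_measure_sublevel {eta : Measure Y} [IsProbabilityMeasure eta] (ψ : Y → ℝ) :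
    ∃ r > 0, 0 < eta.real {y | ψ y ≤ r} := by
  by_contra! h
  have h0 : ∀ n : ℕ, eta {y | ψ y ≤ n + 1} = 0 := fun n => by
    have := le_antisymm (h (n + 1) (by positivity)) measureReal_nonneg
    simpa [measureReal_eq_zero_iff] using this
  have hU : (⋃ n : ℕ, {y | ψ y ≤ n + 1}) = univ := by
    ext y
    obtain ⟨n, hn⟩ := exists_nat_ge (ψ y)
    simp only [mem_iUnion, mem_ofPred_eq, mem_univ, iff_true]
    exact ⟨n, by linarith⟩
  have := measure_iUnion_null h0
  rw [hU, measure_univ] at this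
  exact one_ne_zero this

section Doeblin

variable {eta : Measure Y} [IsProbabilityMeasure eta] {k ψ : Y → ℝ} {B : Set Y} {α β : ℝ}

/-- Bound without minorization: subtracting `α 1_B` costs at most `α` times the weight on `B`, which
is at most `3/2`. -/
theorem integral_abs_sub_indicator_le (hk0 : ∀ y, 0 ≤ k y) (hk : Integrable k eta)
    (hkψ : Integrable (fun y => k y * ψ y) eta) (hk1 : ∫ y, k y ∂eta = 1)
    (hψ : ∀ y, 0 ≤ ψ y) (hB : MeasurableSet B) (hα : 0 ≤ α) (hβ : 0 ≤ β)
    (hBψ : ∀ y ∈ B, β * ψ y ≤ 1 / 2) :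
    ∫ y, |k y - B.indicator (fun _ => α) y| * (1 + β * ψ y) ∂eta
      ≤ 1 + β * ∫ y, k y * ψ y ∂eta + 3 / 2 * α * eta.real B := by
  have hind : Integrable (B.indicator fun _ => α) eta := (integrable_const α).indicator hB
  have hkk : Integrable (fun y => k y + β * (k y * ψ y)) eta := hk.add (hkψ.const_mul β)
  calc ∫ y, |k y - B.indicator (fun _ => α) y| * (1 + β * ψ y) ∂eta
      ≤ ∫ y, (k y + β * (k y * ψ y) + 3 / 2 * B.indicator (fun _ => α) y) ∂eta := by
        refine integral_mono_of_nonneg (Filter.Eventually.of_forall fun y => ?_)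
          ((hk.add (hkψ.const_mul β)).add (hind.const_mul _))
          (Filter.Eventually.of_forall fun y => ?_)
        · have := mul_nonneg hβ (hψ y)
          simp only [Pi.zero_apply]
          positivity
        · have h1 := mul_nonneg hβ (hψ y)
          by_cases hy : y ∈ B
          · have h2 : |k y - α| ≤ k y + α := by
              rw [abs_le]; constructor <;> linarith [hk0 y]
            have h3 := hBψ y hy
            simp only [indicator_of_mem hy]
            nlinarith [mul_le_mul_of_nonneg_left h3 hα, mul_le_mul_of_nonneg_right h2
              (by linarith : 0 ≤ 1 + β * ψ y)]
          · simp only [indicator_of_notMem hy, sub_zero, abs_of_nonneg (hk0 y)]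
            nlinarith
    _ = _ := by
        rw [integral_add hkk (hind.const_mul _),
          integral_add hk (hkψ.const_mul β), integral_const_mul, integral_const_mul,
          integral_indicator_const _ hB, hk1, smul_eq_mul]
        ring

/-- Bound with minorization: where `k ≥ α` on `B` the absolute value opens, and the subtraction
gains at least the mass `α η(B)`. -/
theorem integral_abs_sub_indicator_le_of_le (hk : Integrable k eta)
    (hkψ : Integrable (fun y => k y * ψ y) eta) (hk1 : ∫ y, k y ∂eta = 1) (hk0 : ∀ y, 0 ≤ k y)
    (hψ : ∀ y, 0 ≤ ψ y) (hB : MeasurableSet B) (hα : 0 ≤ α) (hβ : 0 ≤ β)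
    (hkB : ∀ y ∈ B, α ≤ k y) :
    ∫ y, |k y - B.indicator (fun _ => α) y| * (1 + β * ψ y) ∂eta
      ≤ 1 + β * ∫ y, k y * ψ y ∂eta - α * eta.real B := by
  have hind : Integrable (B.indicator fun _ => α) eta := (integrable_const α).indicator hB
  have hkk : Integrable (fun y => k y + β * (k y * ψ y)) eta := hk.add (hkψ.const_mul β)
  calc ∫ y, |k y - B.indicator (fun _ => α) y| * (1 + β * ψ y) ∂eta
      ≤ ∫ y, (k y + β * (k y * ψ y) - B.indicator (fun _ => α) y) ∂eta := by
        refine integral_mono_of_nonneg (Filter.Eventually.of_forall fun y => ?_)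
          ((hk.add (hkψ.const_mul β)).sub hind) (Filter.Eventually.of_forall fun y => ?_)
        · have := mul_nonneg hβ (hψ y)
          simp only [Pi.zero_apply]
          positivity
        · have h1 := mul_nonneg hβ (hψ y)
          by_cases hy : y ∈ B
          · simp only [indicator_of_mem hy]
            rw [abs_of_nonneg (by linarith [hkB y hy])]
            nlinarith [mul_nonneg hα h1]
          · simp only [indicator_of_notMem hy, sub_zero, abs_of_nonneg (hk0 y)]
            nlinarith
    _ = _ := by
        rw [integral_sub hkk hind,
          integral_add hk (hkψ.const_mul β), integral_const_mul,
          integral_indicator_const _ hB, hk1, smul_eq_mul]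
        ring

end Doeblin

/-- A centred function is contracted as soon as the transition density `k` is close to a function
of the second variable only. -/
theorem integral_abs_integral_mul_le {mu : Measure X} [IsProbabilityMeasure mu]
    {eta : Measure Y} [IsProbabilityMeasure eta] {k : X → Y → ℝ} {φ h : X → ℝ} {θ g : Y → ℝ}
    {ρ : ℝ} (hk : ∀ y, Integrable (fun x => h x * k x y) mu) (hh : Integrable h mu)
    (hhφ : Integrable (fun x => |h x| * φ x) mu) (h0 : ∫ x, h x ∂mu = 0) (hg : ∀ y, 0 ≤ g y)
    (hint : Integrable (fun z : X × Y => |h z.1| * (|k z.1 z.2 - θ z.2| * g z.2)) (mu.prod eta))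
    (hJ : ∀ x, ∫ y, |k x y - θ y| * g y ∂eta ≤ ρ * φ x) :
    ∫ y, |∫ x, h x * k x y ∂mu| * g y ∂eta ≤ ρ * ∫ x, |h x| * φ x ∂mu := by
  have hkey : ∀ y, |∫ x, h x * k x y ∂mu| ≤ ∫ x, |h x| * |k x y - θ y| ∂mu := fun y => by
    have : ∫ x, h x * k x y ∂mu = ∫ x, h x * (k x y - θ y) ∂mu := by
      simp_rw [mul_sub]
      rw [integral_sub (hk y) (hh.mul_const _), integral_mul_const, h0, zero_mul, sub_zero]
    rw [this]
    refine (abs_integral_le_integral_abs).trans_eq ?_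
    simp_rw [abs_mul]
  calc ∫ y, |∫ x, h x * k x y ∂mu| * g y ∂eta
      ≤ ∫ y, ∫ x, |h x| * (|k x y - θ y| * g y) ∂mu ∂eta := by
        refine integral_mono_of_nonneg (Filter.Eventually.of_forall fun y => ?_)
          hint.integral_prod_right (Filter.Eventually.of_forall fun y => ?_)
        · exact mul_nonneg (abs_nonneg _) (hg y)
        · simp_rw [← mul_assoc]
          rw [integral_mul_const]
          exact mul_le_mul_of_nonneg_right (hkey y) (hg y)
    _ = ∫ x, ∫ y, |h x| * (|k x y - θ y| * g y) ∂eta ∂mu :=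
        (integral_integral_swap (f := fun x y => |h x| * (|k x y - θ y| * g y)) hint).symm
    _ ≤ ∫ x, ρ * (|h x| * φ x) ∂mu := by
        refine integral_mono_of_nonneg (Filter.Eventually.of_forall fun x => ?_)
          (hhφ.const_mul ρ) (Filter.Eventually.of_forall fun x => ?_)
        · refine integral_nonneg fun y => ?_
          exact mul_nonneg (abs_nonneg _) (mul_nonneg (abs_nonneg _) (hg y))
        · simp only
          rw [integral_const_mul]
          calc |h x| * ∫ y, |k x y - θ y| * g y ∂eta ≤ |h x| * (ρ * φ x) :=
                mul_le_mul_of_nonneg_left (hJ x) (abs_nonneg _)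
            _ = _ := by ring
    _ = _ := integral_const_mul _ _

-- A Harris-type argument. The function subtracted from the transition density is `α 1_B` with `B` a
-- sub-level set of `ψ`; it gains mass where `φ` is small, and where `φ` is large the drift pays for
-- it. All constants depend on `a`, `b` only through their bands, so `ρ` serves every iterate at
-- once.
set_option maxHeartbeats 1000000 in
theorem Admissible.contraction {mu : Measure X} [IsProbabilityMeasure mu]
    {eta : Measure Y} [IsProbabilityMeasure eta] {W : X → Y → ℝ} {φ : X → ℝ} {ψ : Y → ℝ}
    (H : Admissible mu eta W φ ψ) {cX CX cY CY : ℝ} (hcX : 0 < cX) (hcY : 0 < cY)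
    (hCX : 0 < CX) (hCY : 0 < CY) :
    ∃ β₀ > 0, ∀ β, 0 < β → β ≤ β₀ → ∃ ρ, 0 < ρ ∧ ρ < 1 ∧ ∀ a b,
      Band (expCost W eta) cX CX a → Band (expCost (flip W) mu) cY CY b →
      (∀ x, a x * ∫ y, Real.exp (-W x y) * b y ∂eta = 1) →
      ∀ h, Measurable h → Integrable (fun x => |h x| * φ x) mu → ∫ x, h x ∂mu = 0 →
      ∫ y, |∫ x, h x * (a x * Real.exp (-W x y) * b y) ∂mu| * (1 + β * ψ y) ∂eta
        ≤ ρ * ∫ x, |h x| * (1 + β * φ x) ∂mu := by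
  obtain ⟨M, hM, hKM⟩ := H.exists_kernel_le
  obtain ⟨DX, hDX, hφ⟩ := H.exists_expCost_le
  obtain ⟨DY, hDY, hψ⟩ := H.swap.exists_expCost_le
  obtain ⟨r, hr, hB0⟩ := exists_pos_measure_sublevel (eta := eta) ψ
  obtain ⟨c₀, hc₀, hφ0⟩ := H.lower_left
  set B := {y | ψ y ≤ r} with hBdef
  have hB : MeasurableSet B := measurableSet_le H.measurable_right measurable_const
  set I := ∫ y, ψ y ^ 2 ∂eta with hI
  have hI0 : 0 ≤ I := integral_nonneg fun y => sq_nonneg _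
  set A := CX * M * (CY * DY) with hA
  have hApos : 0 < A := by positivity
  obtain ⟨C₁, hC₁⟩ := H.dom_left (1 / (4 * (A * I + 1))) (by positivity)
  set C₀ := (A * I + 1) * |C₁| + 1 with hC₀
  have hC₀pos : 0 < C₀ := by positivity
  -- Drift: `A I e^{W^V}` dominates the integral of `ψ` against the transition density, and
  -- `e^{W^V}` is at most a small multiple of `φ` plus a constant.
  have hdrift : ∀ x, A * I * expCost W eta x ≤ φ x / 4 + C₀ := fun x => by
    have h1 := hC₁ x
    have h2 := expCost_pos W eta x
    have h3 : A * I * expCost W eta x ≤ (A * I + 1) * expCost W eta x := by nlinarith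
    have h4 : (A * I + 1) * expCost W eta x
        ≤ (A * I + 1) * (1 / (4 * (A * I + 1)) * φ x + |C₁|) :=
      mul_le_mul_of_nonneg_left (h1.trans (by linarith [le_abs_self C₁])) (by positivity)
    have h5 : (A * I + 1) * (1 / (4 * (A * I + 1)) * φ x + |C₁|)
        = φ x / 4 + (A * I + 1) * |C₁| := by
      field_simp
    linarith
  -- `10 C₀` is the threshold beyond which the drift absorbs the cost of the subtraction: `φ/2` must
  -- exceed `5 C₀`.
  obtain ⟨CW, hCW⟩ := H.bdd_sublevel (max (10 * C₀) r)
  set α₀ := cX * Real.exp (-CW) * cY with hα₀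
  have hα₀pos : 0 < α₀ := by positivity
  -- The first bound on `β` ensures `α ≤ α₀`, the second that the weight is at most `3/2` on `B`.
  refine ⟨min (α₀ * eta.real B / (2 * C₀)) (1 / (2 * r)), by positivity, fun β hβ hβle => ?_⟩
  have hβ1 : 2 * C₀ * β ≤ α₀ * eta.real B := by
    have := (le_div_iff₀ (by positivity)).1 (hβle.trans (min_le_left _ _))
    linarith
  have hβ2 : β * r ≤ 1 / 2 := by
    have := (le_div_iff₀ (by positivity)).1 (hβle.trans (min_le_right _ _))
    linarith
  -- Chosen so that the gain `α η(B) = 2 C₀ β` is twice the additive drift term `β C₀`.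
  set α := 2 * C₀ * β / eta.real B with hα
  have hαpos : 0 < α := by positivity
  have hαB : α * eta.real B = 2 * C₀ * β := div_mul_cancel₀ _ hB0.ne'
  have hαα₀ : α ≤ α₀ := (div_le_iff₀ hB0).2 hβ1
  refine ⟨max (3 / 4) (1 - β * C₀), by positivity, ?_, ?_⟩
  · exact max_lt (by norm_num) (by nlinarith [mul_pos hβ hC₀pos])
  set ρ := max (3 / 4) (1 - β * C₀) with hρ
  have hρ1 : 3 / 4 ≤ ρ := le_max_left _ _
  have hρ2 : 1 - β * C₀ ≤ ρ := le_max_right _ _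
  intro a b ha hb hab h hhm hhφ h0
  have hb_le : ∀ y, b y ≤ CY * DY * ψ y := fun y => by
    calc b y ≤ CY * expCost (flip W) mu y := hb.upper y
      _ ≤ CY * (DY * ψ y) := mul_le_mul_of_nonneg_left (hψ y) hCY.le
      _ = _ := by ring
  have hmk : Measurable (fun z : X × Y => a z.1 * Real.exp (-W z.1 z.2) * b z.2) :=
    ((ha.meas.comp measurable_fst).mul H.measurable_kernel).mul (hb.meas.comp measurable_snd)
  have hk0 : ∀ x y, 0 < a x * Real.exp (-W x y) * b y := fun x y =>
    mul_pos (mul_pos (ha.pos hcX x) (Real.exp_pos _)) (hb.pos hcY y)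
  have hk_le : ∀ x y, a x * Real.exp (-W x y) * b y ≤ A * expCost W eta x * ψ y := fun x y => by
    have h1 : a x * Real.exp (-W x y) ≤ CX * expCost W eta x * M :=
      mul_le_mul (ha.upper x) (hKM x y) (Real.exp_pos _).le
        (mul_nonneg hCX.le (expCost_pos W eta x).le)
    calc a x * Real.exp (-W x y) * b y ≤ CX * expCost W eta x * M * (CY * DY * ψ y) :=
          mul_le_mul h1 (hb_le y) (hb.pos hcY y).le
            (mul_nonneg (mul_nonneg hCX.le (expCost_pos W eta x).le) hM.le)
      _ = _ := by rw [hA]; ring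
  have hk_int : ∀ x, Integrable (fun y => a x * Real.exp (-W x y) * b y) eta := fun x => by
    refine (H.integrable_psi.const_mul (A * expCost W eta x)).mono'
      (hmk.comp measurable_prodMk_left).aestronglyMeasurable ?_
    filter_upwards with y
    rw [Real.norm_eq_abs, abs_of_pos (hk0 x y)]
    exact hk_le x y
  have hkψ_le : ∀ x y, a x * Real.exp (-W x y) * b y * ψ y ≤ A * expCost W eta x * ψ y ^ 2 :=
    fun x y => by
      calc _ ≤ A * expCost W eta x * ψ y * ψ y :=
            mul_le_mul_of_nonneg_right (hk_le x y) (H.right_pos y).le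
        _ = _ := by ring
  have hkψ_int : ∀ x, Integrable (fun y => a x * Real.exp (-W x y) * b y * ψ y) eta :=
    fun x => by
      refine (H.sq_right.const_mul (A * expCost W eta x)).mono'
        ((hmk.comp measurable_prodMk_left).mul H.measurable_right).aestronglyMeasurable ?_
      filter_upwards with y
      rw [Real.norm_eq_abs, abs_of_pos (mul_pos (hk0 x y) (H.right_pos y))]
      exact hkψ_le x y
  have hkψ_le' : ∀ x, ∫ y, a x * Real.exp (-W x y) * b y * ψ y ∂eta ≤ φ x / 4 + C₀ := fun x => by
    refine (integral_mono (hkψ_int x) (H.sq_right.const_mul (A * expCost W eta x))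
      (hkψ_le x)).trans ?_
    rw [integral_const_mul]
    calc _ = A * I * expCost W eta x := by rw [hI]; ring
      _ ≤ _ := hdrift x
  have hk1 : ∀ x, ∫ y, a x * Real.exp (-W x y) * b y ∂eta = 1 := fun x => by
    simp_rw [mul_assoc]
    rw [integral_const_mul, hab x]
  have hψ0 : ∀ y, 0 ≤ ψ y := fun y => (H.right_pos y).le
  -- In `ρ (1 + βφ)` the factor `ρ` is bounded below by `1 - βC₀` on the constant term and by `3/4`
  -- on the term `βφ`.
  have hJ : ∀ x, ∫ y, |a x * Real.exp (-W x y) * b y - B.indicator (fun _ => α) y|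
      * (1 + β * ψ y) ∂eta ≤ ρ * (1 + β * φ x) := fun x => by
    have hβφ : 0 < β * φ x := mul_pos hβ (H.left_pos x)
    have hβint := mul_le_mul_of_nonneg_left (hkψ_le' x) hβ.le
    rcases le_or_gt (φ x) (10 * C₀) with hx | hx
    · have := integral_abs_sub_indicator_le_of_le (hk_int x) (hkψ_int x) (hk1 x)
        (fun y => (hk0 x y).le) hψ0 hB hαpos.le hβ.le (fun y hy => by
          refine hαα₀.trans ?_
          refine mul_le_mul (mul_le_mul (ha.lower x) (Real.exp_le_exp.2 ?_)
            (Real.exp_pos _).le (ha.pos hcX x).le) (hb.lower y) hcY.le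
            (mul_pos (ha.pos hcX x) (Real.exp_pos _)).le
          have := hCW x y (hx.trans (le_max_left _ _)) (le_trans hy (le_max_right _ _))
          linarith)
      refine this.trans ?_
      rw [hαB]
      nlinarith
    · have := integral_abs_sub_indicator_le (fun y => (hk0 x y).le) (hk_int x) (hkψ_int x) (hk1 x)
        hψ0 hB hαpos.le hβ.le (fun y hy => (mul_le_mul_of_nonneg_left hy hβ.le).trans hβ2)
      refine this.trans ?_
      have h1 : 3 / 2 * α * eta.real B = 3 * (C₀ * β) := by rw [mul_assoc, hαB]; ring
      rw [h1]
      have h2 := mul_lt_mul_of_pos_left hx hβ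
      nlinarith
  have hφinv : ∀ x, 1 ≤ c₀⁻¹ * φ x := fun x => by
    rw [inv_mul_eq_div, one_le_div hc₀]; exact hφ0 x
  have hh : Integrable h mu := by
    refine (hhφ.const_mul c₀⁻¹).mono' hhm.aestronglyMeasurable ?_
    filter_upwards with x
    rw [Real.norm_eq_abs]
    nlinarith [hφinv x, abs_nonneg (h x)]
  refine integral_abs_integral_mul_le (φ := fun x => 1 + β * φ x) (g := fun y => 1 + β * ψ y)
    (k := fun x y => a x * Real.exp (-W x y) * b y) (θ := B.indicator fun _ => α)
    (fun y => ?_) hh ?_ h0 (fun y => by have := mul_nonneg hβ.le (hψ0 y); positivity) ?_ hJ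
  · refine (hhφ.const_mul (A * DX * ψ y)).mono'
      (hhm.mul (hmk.comp measurable_prodMk_right)).aestronglyMeasurable ?_
    filter_upwards with x
    rw [Real.norm_eq_abs, abs_mul, abs_of_pos (hk0 x y)]
    calc |h x| * (a x * Real.exp (-W x y) * b y) ≤ |h x| * (A * (DX * φ x) * ψ y) := by
          refine mul_le_mul_of_nonneg_left ((hk_le x y).trans ?_) (abs_nonneg _)
          exact mul_le_mul_of_nonneg_right (mul_le_mul_of_nonneg_left (hφ x) hApos.le) (hψ0 y)
      _ = _ := by ring
  · simp_rw [mul_add, mul_one]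
    refine hh.abs.add ((hhφ.const_mul β).congr ?_)
    filter_upwards with x
    ring
  · have hdom : Integrable (fun z : X × Y => (|h z.1| * φ z.1) * ((A * DX + c₀⁻¹ * α)
        * (1 + ψ z.2) * (1 + β * ψ z.2))) (mu.prod eta) := by
      refine hhφ.mul_prod (g := fun y => (A * DX + c₀⁻¹ * α) * (1 + ψ y) * (1 + β * ψ y)) ?_
      have : Integrable (fun y => (A * DX + c₀⁻¹ * α)
          * (1 + (1 + β) * ψ y + β * ψ y ^ 2)) eta :=
        (((integrable_const 1).add (H.integrable_psi.const_mul _)).add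
          (H.sq_right.const_mul _)).const_mul _
      refine this.congr ?_
      filter_upwards with y
      ring
    refine hdom.mono' ?_ ?_
    · refine Measurable.aestronglyMeasurable ?_
      have hθ : Measurable (B.indicator fun _ => α) := measurable_const.indicator hB
      exact ((hhm.comp measurable_fst).abs).mul (((hmk.sub (hθ.comp measurable_snd)).abs).mul
        (measurable_const.add ((H.measurable_right.comp measurable_snd).const_mul β)))
    · filter_upwards with z
      have h1 : 0 ≤ 1 + β * ψ z.2 := by have := mul_nonneg hβ.le (hψ0 z.2); positivity
      rw [Real.norm_eq_abs, abs_mul, abs_abs, abs_mul, abs_abs, abs_of_nonneg h1]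
      have h2 : B.indicator (fun _ => α) z.2 ≤ α := indicator_le_self' (fun _ _ => hαpos.le) _
      have h3 : 0 ≤ B.indicator (fun _ => α) z.2 := indicator_nonneg (fun _ _ => hαpos.le) _
      have h4 : |a z.1 * Real.exp (-W z.1 z.2) * b z.2 - B.indicator (fun _ => α) z.2|
          ≤ a z.1 * Real.exp (-W z.1 z.2) * b z.2 + α := by
        rw [abs_le]; constructor <;> linarith [hk0 z.1 z.2]
      have h5 : a z.1 * Real.exp (-W z.1 z.2) * b z.2 ≤ A * (DX * φ z.1) * ψ z.2 :=
        (hk_le z.1 z.2).trans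
          (mul_le_mul_of_nonneg_right (mul_le_mul_of_nonneg_left (hφ z.1) hApos.le) (hψ0 z.2))
      have h6 : α ≤ c₀⁻¹ * α * φ z.1 := by
        calc α = α * 1 := (mul_one _).symm
          _ ≤ α * (c₀⁻¹ * φ z.1) := mul_le_mul_of_nonneg_left (hφinv z.1) hαpos.le
          _ = _ := by ring
      have h7 : |a z.1 * Real.exp (-W z.1 z.2) * b z.2 - B.indicator (fun _ => α) z.2|
          ≤ φ z.1 * ((A * DX + c₀⁻¹ * α) * (1 + ψ z.2)) := by
        refine h4.trans ((add_le_add h5 h6).trans ?_)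
        have e1 : 0 ≤ A * DX * φ z.1 := by have := H.left_pos z.1; positivity
        have e2 : 0 ≤ c₀⁻¹ * α * φ z.1 * ψ z.2 := by
          have := H.left_pos z.1; have := hψ0 z.2; positivity
        nlinarith
      calc _ ≤ |h z.1| * (φ z.1 * ((A * DX + c₀⁻¹ * α) * (1 + ψ z.2)) * (1 + β * ψ z.2)) :=
            mul_le_mul_of_nonneg_left (mul_le_mul_of_nonneg_right h7 h1) (abs_nonneg _)
        _ = _ := by ring

end Contraction

/-! ### Scaling functions, their monotone log integrals and uniform bounds -/

section Potentials

variable {X Y : Type*} [MeasurableSpace X] [MeasurableSpace Y]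

theorem integral_pos_of_forall_pos {mu : Measure X} [IsProbabilityMeasure mu] {f : X → ℝ}
    (hf : Integrable f mu) (h : ∀ x, 0 < f x) : 0 < ∫ x, f x ∂mu := by
  rw [integral_pos_iff_support_of_nonneg (fun x => (h x).le) hf]
  have : Function.support f = univ := eq_univ_of_forall fun x => (h x).ne'
  rw [this, measure_univ]
  exact one_pos

/-- Jensen's inequality through `log t ≤ t - 1`. With `b/b'` the density of a marginal, it makes the
log integrals monotone along the iteration. -/
theorem integral_log_le_integral_log {mu : Measure X} [IsProbabilityMeasure mu] {b b' : X → ℝ}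
    (hb : ∀ x, 0 < b x) (hb' : ∀ x, 0 < b' x) (hlb : Integrable (fun x => Real.log (b x)) mu)
    (hlb' : Integrable (fun x => Real.log (b' x)) mu) (hi : Integrable (fun x => b x / b' x) mu)
    (h1 : ∫ x, b x / b' x ∂mu = 1) : ∫ x, Real.log (b x) ∂mu ≤ ∫ x, Real.log (b' x) ∂mu := by
  have h : ∫ x, (Real.log (b x) - Real.log (b' x)) ∂mu ≤ ∫ x, (b x / b' x - 1) ∂mu := by
    refine integral_mono (hlb.sub hlb') (hi.sub (integrable_const 1)) fun x => ?_
    simp only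
    rw [← Real.log_div (hb x).ne' (hb' x).ne']
    exact Real.log_le_sub_one_of_pos (div_pos (hb x) (hb' x))
  rw [integral_sub hlb hlb', integral_sub hi (integrable_const 1), h1] at h
  simp only [integral_const, probReal_univ, smul_eq_mul, mul_one, sub_self] at h
  linarith

/-- The Sinkhorn update `b ↦ (∫ e^{-W(·,y)} b(y) η(dy))⁻¹` of the scaling functions. -/
noncomputable def scaling (W : X → Y → ℝ) (eta : Measure Y) (b : Y → ℝ) (x : X) : ℝ :=
  (∫ y, Real.exp (-W x y) * b y ∂eta)⁻¹

section Update

variable {mu : Measure X} [IsProbabilityMeasure mu] {eta : Measure Y} [IsProbabilityMeasure eta]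
  {W : X → Y → ℝ} {φ : X → ℝ} {ψ : Y → ℝ} {b : Y → ℝ}

omit [IsProbabilityMeasure eta] in
theorem measurable_scaling [SFinite eta] (hW : Measurable (Function.uncurry W))
    (hb : Measurable b) : Measurable (scaling W eta b) := by
  have : Measurable (fun z : X × Y => Real.exp (-W z.1 z.2) * b z.2) :=
    (hW.neg.exp).mul (hb.comp measurable_snd)
  exact (this.stronglyMeasurable.integral_prod_right (ν := eta)).measurable.inv

omit [MeasurableSpace X] in
theorem scaling_pos {x : X} (hb : ∀ y, 0 < b y)
    (hi : Integrable (fun y => Real.exp (-W x y) * b y) eta) : 0 < scaling W eta b x :=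
  inv_pos.2 (integral_pos_of_forall_pos hi fun y => mul_pos (Real.exp_pos _) (hb y))

omit [MeasurableSpace X] in
theorem scaling_mul {x : X} (hb : ∀ y, 0 < b y)
    (hi : Integrable (fun y => Real.exp (-W x y) * b y) eta) :
    scaling W eta b x * ∫ y, Real.exp (-W x y) * b y ∂eta = 1 :=
  inv_mul_cancel₀ (integral_pos_of_forall_pos hi fun y => mul_pos (Real.exp_pos _) (hb y)).ne'

-- Jensen's inequality for `exp` under `η`, applied to `log b - W(x,·)`: only the mean of `log b`
-- enters, and that mean is controlled along the iteration.
omit [MeasurableSpace X] in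
theorem scaling_le {x : X} (hb : ∀ y, 0 < b y) (hlb : Integrable (fun y => Real.log (b y)) eta)
    (hWi : Integrable (fun y => W x y) eta)
    (hi : Integrable (fun y => Real.exp (-W x y) * b y) eta) :
    scaling W eta b x ≤ Real.exp (-∫ y, Real.log (b y) ∂eta) * expCost W eta x := by
  set Z := ∫ y, Real.exp (-W x y) * b y ∂eta with hZ
  have hZpos : 0 < Z := integral_pos_of_forall_pos hi fun y => mul_pos (Real.exp_pos _) (hb y)
  have h : ∫ y, (Real.log (b y) - W x y) ∂eta
      ≤ ∫ y, (Real.exp (-W x y) * b y * Z⁻¹ + (Real.log Z - 1)) ∂eta := by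
    refine integral_mono (hlb.sub hWi) ((hi.mul_const _).add (integrable_const _)) fun y => ?_
    have hp : 0 < Real.exp (-W x y) * b y := mul_pos (Real.exp_pos _) (hb y)
    have := Real.log_le_sub_one_of_pos (mul_pos hp (inv_pos.2 hZpos))
    rw [Real.log_mul hp.ne' (inv_pos.2 hZpos).ne', Real.log_mul (Real.exp_pos _).ne' (hb y).ne',
      Real.log_exp, Real.log_inv] at this
    simp only
    linarith
  rw [integral_sub hlb hWi, integral_add (hi.mul_const _) (integrable_const _),
    integral_mul_const, ← hZ, mul_inv_cancel₀ hZpos.ne'] at h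
  simp only [integral_const, probReal_univ, smul_eq_mul, one_mul] at h
  rw [expCost, ← Real.exp_add, scaling, ← hZ, ← Real.exp_log (inv_pos.2 hZpos), Real.log_inv]
  refine Real.exp_le_exp.2 ?_
  simp only [costX]
  linarith

omit [MeasurableSpace X] in
theorem le_scaling {x : X} {M : ℝ} (hM : ∀ y, Real.exp (-W x y) ≤ M) (hb : ∀ y, 0 < b y)
    (hbi : Integrable b eta) (hi : Integrable (fun y => Real.exp (-W x y) * b y) eta) :
    (M * ∫ y, b y ∂eta)⁻¹ ≤ scaling W eta b x := by
  refine inv_anti₀ (integral_pos_of_forall_pos hi fun y => mul_pos (Real.exp_pos _) (hb y)) ?_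
  rw [← integral_const_mul]
  exact integral_mono hi (hbi.const_mul M) fun y => mul_le_mul_of_nonneg_right (hM y) (hb y).le

omit [IsProbabilityMeasure mu] [IsProbabilityMeasure eta] in
theorem Admissible.integrable_kernel_mul (H : Admissible mu eta W φ ψ) (hb : Integrable b eta)
    (x : X) : Integrable (fun y => Real.exp (-W x y) * b y) eta := by
  obtain ⟨M, -, hM⟩ := H.exists_kernel_le
  refine hb.bdd_mul (c := M)
    (H.measurable_kernel.comp measurable_prodMk_left).aestronglyMeasurable ?_
  filter_upwards with y
  rw [Real.norm_eq_abs, abs_of_pos (Real.exp_pos _)]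
  exact hM x y

/-- The transition density `a K b` integrates to one over the product space. -/
theorem integrable_scaling_prod (hW : Measurable (Function.uncurry W)) (hbm : Measurable b)
    (hb : ∀ y, 0 < b y) (hi : ∀ x, Integrable (fun y => Real.exp (-W x y) * b y) eta) :
    Integrable (fun z : X × Y => scaling W eta b z.1 * (Real.exp (-W z.1 z.2) * b z.2))
      (mu.prod eta) := by
  have hm : Measurable
      (fun z : X × Y => scaling W eta b z.1 * (Real.exp (-W z.1 z.2) * b z.2)) :=
    ((measurable_scaling hW hbm).comp measurable_fst).mul
      (hW.neg.exp.mul (hbm.comp measurable_snd))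
  rw [integrable_prod_iff hm.aestronglyMeasurable]
  refine ⟨Filter.Eventually.of_forall fun x => (hi x).const_mul (scaling W eta b x), ?_⟩
  refine (integrable_const (1 : ℝ)).congr (Filter.Eventually.of_forall fun x => ?_)
  have : ∀ y, ‖scaling W eta b x * (Real.exp (-W x y) * b y)‖
      = scaling W eta b x * (Real.exp (-W x y) * b y) := fun y =>
    Real.norm_of_nonneg (mul_nonneg (scaling_pos hb (hi x)).le
      (mul_nonneg (Real.exp_pos _).le (hb y).le))
  simp only [this]
  rw [integral_const_mul, scaling_mul hb (hi x)]

omit [MeasurableSpace Y] [IsProbabilityMeasure mu] in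
theorem div_scaling_eq {a : X → ℝ} (y : Y) :
    b y / scaling (flip W) mu a y = ∫ x, a x * (Real.exp (-W x y) * b y) ∂mu := by
  rw [scaling, div_inv_eq_mul, ← integral_const_mul]
  refine integral_congr_ae (Filter.Eventually.of_forall fun x => ?_)
  simp only [flip]
  ring

theorem integrable_div_scaling (hW : Measurable (Function.uncurry W)) (hbm : Measurable b)
    (hb : ∀ y, 0 < b y) (hi : ∀ x, Integrable (fun y => Real.exp (-W x y) * b y) eta) :
    Integrable (fun y => b y / scaling (flip W) mu (scaling W eta b) y) eta := by
  refine (integrable_scaling_prod (mu := mu) hW hbm hb hi).integral_prod_right.congr ?_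
  filter_upwards with y
  rw [div_scaling_eq]

/-- By Fubini this is the total mass of `a e^{-W} b`, whose integral in `y` is one for each `x`. -/
theorem integral_div_scaling (hW : Measurable (Function.uncurry W)) (hbm : Measurable b)
    (hb : ∀ y, 0 < b y) (hi : ∀ x, Integrable (fun y => Real.exp (-W x y) * b y) eta) :
    ∫ y, b y / scaling (flip W) mu (scaling W eta b) y ∂eta = 1 := by
  simp_rw [div_scaling_eq]
  have hint := integrable_scaling_prod (mu := mu) hW hbm hb hi
  rw [← integral_integral_swap (f := fun x y => scaling W eta b x * (Real.exp (-W x y) * b y)) hint]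
  simp_rw [integral_const_mul, scaling_mul hb (hi _)]
  simp

/-- One step of the induction: a lower bound on the log integral of `a` bounds the new factor above,
the upper bound on `a` bounds it below, and the lower bound `v` passes on by monotonicity. -/
theorem Admissible.band_scaling (H : Admissible mu eta W φ ψ) {M v u cX CX : ℝ} (hM0 : 0 < M)
    (hM : ∀ x y, Real.exp (-W x y) ≤ M) (hbm : Measurable b) (hb : ∀ y, 0 < b y)
    (hi : ∀ x, Integrable (fun y => Real.exp (-W x y) * b y) eta)
    (hlb : Integrable (fun y => Real.log (b y)) eta) (hv : v ≤ ∫ y, Real.log (b y) ∂eta)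
    (hcX : 0 < cX) (ha : Band (expCost W eta) cX CX (scaling W eta b))
    (hu : u ≤ ∫ x, Real.log (scaling W eta b x) ∂mu) :
    Band (expCost (flip W) mu) (M * (CX * ∫ x, expCost W eta x ∂mu))⁻¹ (Real.exp (-u))
        (scaling (flip W) mu (scaling W eta b)) ∧
      v ≤ ∫ y, Real.log (scaling (flip W) mu (scaling W eta b) y) ∂eta := by
  have hG := H.integrable_expCost
  have hai : Integrable (scaling W eta b) mu := ha.integrable hcX hG
  have hai' := H.swap.integrable_kernel_mul hai
  have hGpos := integral_pos_of_forall_pos hG (expCost_pos W eta)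
  have hapos := integral_pos_of_forall_pos hai (ha.pos hcX)
  have hale : ∫ x, scaling W eta b x ∂mu ≤ CX * ∫ x, expCost W eta x ∂mu := by
    rw [← integral_const_mul]
    exact integral_mono hai (hG.const_mul CX) ha.upper
  have hband : Band (expCost (flip W) mu) (M * (CX * ∫ x, expCost W eta x ∂mu))⁻¹ (Real.exp (-u))
      (scaling (flip W) mu (scaling W eta b)) := by
    refine ⟨measurable_scaling H.swap.measurable_cost ha.meas, fun y => ?_, fun y => ?_⟩
    · refine le_trans ?_ (le_scaling (fun x => hM x y) (ha.pos hcX) hai (hai' y))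
      exact inv_anti₀ (by positivity) (mul_le_mul_of_nonneg_left hale hM0.le)
    · refine (scaling_le (ha.pos hcX) (ha.integrable_log hcX hG) (H.integrable_right y)
        (hai' y)).trans ?_
      exact mul_le_mul_of_nonneg_right (Real.exp_le_exp.2 (by linarith)) (expCost_pos _ _ _).le
  refine ⟨hband, hv.trans ?_⟩
  have hc : 0 < (M * (CX * ∫ x, expCost W eta x ∂mu))⁻¹ :=
    inv_pos.2 (mul_pos hM0 (hapos.trans_le hale))
  exact integral_log_le_integral_log hb (hband.pos hc) hlb
    (hband.integrable_log hc H.swap.integrable_expCost)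
    (integrable_div_scaling H.measurable_cost hbm hb hi)
    (integral_div_scaling H.measurable_cost hbm hb hi)

end Update

/-- The scaling functions of the second variable along the Sinkhorn iteration. -/
noncomputable def potY (mu : Measure X) (eta : Measure Y) (W : X → Y → ℝ) (V : Y → ℝ) :
    ℕ → Y → ℝ
  | 0 => fun y => Real.exp (V y)
  | n + 1 => scaling (flip W) mu (scaling W eta (potY mu eta W V n))

/-- The scaling functions of the first variable along the Sinkhorn iteration. -/
noncomputable def potX (mu : Measure X) (eta : Measure Y) (W : X → Y → ℝ) (V : Y → ℝ) (n : ℕ) :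
    X → ℝ :=
  scaling W eta (potY mu eta W V n)

/-- The initial potential is integrable and normalizes the reference transition. -/
structure Normalized (eta : Measure Y) (W : X → Y → ℝ) (V : Y → ℝ) : Prop where
  meas : Measurable V
  integrable : Integrable V eta
  integrable_kernel : ∀ x, Integrable (fun y => Real.exp (-W x y) * Real.exp (V y)) eta
  integral_kernel : ∀ x, ∫ y, Real.exp (-W x y) * Real.exp (V y) ∂eta = 1

section Bounds

variable {mu : Measure X} [IsProbabilityMeasure mu] {eta : Measure Y} [IsProbabilityMeasure eta]
  {W : X → Y → ℝ} {φ : X → ℝ} {ψ : Y → ℝ} {V : Y → ℝ}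

/-- Uniform two-sided bounds on the scaling functions of the Sinkhorn iteration. -/
theorem Admissible.exists_bands (H : Admissible mu eta W φ ψ) (hV : Normalized eta W V) :
    ∃ cX > 0, ∃ CX > 0, ∃ cY > 0, ∃ CY > 0, ∀ n,
      Band (expCost W eta) cX CX (potX mu eta W V n) ∧
      Band (expCost (flip W) mu) cY CY (potY mu eta W V (n + 1)) := by
  obtain ⟨M, hM0, hM⟩ := H.exists_kernel_le
  set v := ∫ y, V y ∂eta with hv
  have hGX := H.integrable_expCost
  have hGY := H.swap.integrable_expCost
  have hGXpos := integral_pos_of_forall_pos hGX (expCost_pos W eta)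
  have hGYpos := integral_pos_of_forall_pos hGY (expCost_pos (flip W) mu)
  set CX := Real.exp (-v) with hCX
  have hCXpos : 0 < CX := Real.exp_pos _
  -- The minimum with `1` covers the initial factor `a_0 = 1`, which is not given by `band_scaling`.
  set cX := min 1 (M * (1 * ∫ y, expCost (flip W) mu y ∂eta))⁻¹ with hcX
  have hcXpos : 0 < cX := lt_min one_pos (by positivity)
  set cY := (M * (CX * ∫ x, expCost W eta x ∂mu))⁻¹ with hcY
  have hcYpos : 0 < cY := by positivity
  -- The band for the second variable is absent at step `n`: the initial factor `e^V` need not lie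
  -- in it, so only its integrability and log integral are tracked.
  let P : ℕ → Prop := fun n => Measurable (potY mu eta W V n) ∧ (∀ y, 0 < potY mu eta W V n y) ∧
    (∀ x, Integrable (fun y => Real.exp (-W x y) * potY mu eta W V n y) eta) ∧
    Integrable (fun y => Real.log (potY mu eta W V n y)) eta ∧
    v ≤ ∫ y, Real.log (potY mu eta W V n y) ∂eta ∧
    Band (expCost W eta) cX CX (potX mu eta W V n) ∧
    0 ≤ ∫ x, Real.log (potX mu eta W V n x) ∂mu
  have hstep : ∀ n, P n → Band (expCost (flip W) mu) cY 1 (potY mu eta W V (n + 1)) ∧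
      v ≤ ∫ y, Real.log (potY mu eta W V (n + 1) y) ∂eta := by
    rintro n ⟨hbm, hb, hi, hlb, hvb, ha, hla⟩
    have := H.band_scaling hM0 hM hbm hb hi hlb hvb hcXpos ha hla
    rwa [neg_zero, Real.exp_zero] at this
  have hP : ∀ n, P n := by
    intro n
    induction n with
    | zero =>
      have hone : potX mu eta W V 0 = fun _ => 1 := by
        ext x
        simp [potX, potY, scaling, hV.integral_kernel x]
      refine ⟨hV.meas.exp, fun y => Real.exp_pos _, hV.integrable_kernel, ?_, ?_, ?_, ?_⟩
      · simpa [potY] using hV.integrable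
      · simp [potY, hv]
      · rw [hone]
        refine ⟨measurable_const, fun x => min_le_left _ _, fun x => ?_⟩
        -- As `a_0 = 1` is itself the update of `e^V`, Jensen's bound gives `1 ≤ exp(-v) e^{W^V}`.
        have := scaling_le (b := potY mu eta W V 0) (W := W) (x := x)
          (fun y => Real.exp_pos (V y)) (by simpa [potY] using hV.integrable)
          (H.integrable_left x) (hV.integrable_kernel x)
        rw [← potX, hone] at this
        simpa [potY] using this
      · simp [hone]
    | succ n ih =>
      obtain ⟨hY, hvY⟩ := hstep n ih
      obtain ⟨hbm, hb, hi, hlb, hvb, ha, hla⟩ := ih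
      have hbi := hY.integrable hcYpos hGY
      have hXi := ha.integrable hcXpos hGX
      have h1 := H.swap.band_scaling hM0 (fun y x => hM x y) ha.meas (ha.pos hcXpos)
        (H.swap.integrable_kernel_mul hXi) (ha.integrable_log hcXpos hGX) hla hcYpos hY hvY
      refine ⟨hY.meas, hY.pos hcYpos, H.integrable_kernel_mul hbi,
        hY.integrable_log hcYpos hGY, hvY, ?_, h1.2⟩
      exact h1.1.mono (fun x => (expCost_pos _ _ _).le) (min_le_right _ _) le_rfl
  exact ⟨cX, hcXpos, CX, hCXpos, cY, hcYpos, 1, one_pos,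
    fun n => ⟨(hP n).2.2.2.2.2.1, (hstep n (hP n)).1⟩⟩

end Bounds

end Potentials

/-! ### Geometric decay of marginal errors and of log increments -/

section Convergence

variable {X Y : Type*} [MeasurableSpace X] [MeasurableSpace Y]
  {mu : Measure X} [IsProbabilityMeasure mu] {eta : Measure Y} [IsProbabilityMeasure eta]
  {W : X → Y → ℝ} {φ : X → ℝ} {ψ : Y → ℝ} {cX CX cY CY : ℝ}

-- The ratio grows at most like `φ`, so the product with the weight is controlled by `φ²`; this is
-- where square integrability of the weight is needed.
omit [IsProbabilityMeasure eta] in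
theorem Admissible.integrable_abs_div_sub_one (H : Admissible mu eta W φ ψ) {a₀ a₁ : X → ℝ}
    (hc : 0 < cX) (hC : 0 < CX) (h₀ : Band (expCost W eta) cX CX a₀)
    (h₁ : Band (expCost W eta) cX CX a₁) :
    Integrable (fun x => |a₀ x / a₁ x - 1| * φ x) mu := by
  obtain ⟨D, hD, hφ⟩ := H.exists_expCost_le
  have hm : Measurable (fun x => |a₀ x / a₁ x - 1| * φ x) :=
    (((h₀.meas.div h₁.meas).sub_const 1).abs).mul H.measurable_left
  refine ((H.sq_left.const_mul (CX * D / cX)).add H.integrable_phi).mono'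
    hm.aestronglyMeasurable ?_
  filter_upwards with x
  have hφ0 := H.left_pos x
  have h1 : a₀ x / a₁ x ≤ CX * D * φ x / cX := by
    refine div_le_div₀ (by positivity) ((h₀.upper x).trans ?_) hc (h₁.lower x)
    rw [mul_assoc]
    exact mul_le_mul_of_nonneg_left (hφ x) hC.le
  have h2 : 0 < a₀ x / a₁ x := div_pos (h₀.pos hc x) (h₁.pos hc x)
  have h3 : |a₀ x / a₁ x - 1| ≤ CX * D * φ x / cX + 1 := by
    rw [abs_le]; constructor <;> linarith
  rw [Real.norm_eq_abs, abs_mul, abs_abs, abs_of_pos hφ0]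
  calc |a₀ x / a₁ x - 1| * φ x ≤ (CX * D * φ x / cX + 1) * φ x :=
        mul_le_mul_of_nonneg_right h3 hφ0.le
    _ = _ := by simp only [Pi.add_apply]; ring

omit [IsProbabilityMeasure eta] in
theorem Admissible.integrable_abs_div_sub_one' (H : Admissible mu eta W φ ψ) {a₀ a₁ : X → ℝ}
    (hc : 0 < cX) (hC : 0 < CX) (h₀ : Band (expCost W eta) cX CX a₀)
    (h₁ : Band (expCost W eta) cX CX a₁) :
    Integrable (fun x => |a₀ x / a₁ x - 1|) mu := by
  obtain ⟨c, hc0, hφ⟩ := H.lower_left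
  refine ((H.integrable_abs_div_sub_one hc hC h₀ h₁).const_mul c⁻¹).mono'
    ((h₀.meas.div h₁.meas).sub_const 1).abs.aestronglyMeasurable ?_
  filter_upwards with x
  rw [Real.norm_eq_abs, abs_abs]
  have : 1 ≤ c⁻¹ * φ x := by
    rw [inv_mul_eq_div, one_le_div hc0]; exact hφ x
  nlinarith [abs_nonneg (a₀ x / a₁ x - 1)]

omit [IsProbabilityMeasure eta] in
theorem Admissible.integral_mul_le_weighted (H : Admissible mu eta W φ ψ) {a₀ a₁ : X → ℝ}
    (hc : 0 < cX) (hC : 0 < CX) (h₀ : Band (expCost W eta) cX CX a₀)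
    (h₁ : Band (expCost W eta) cX CX a₁) {β : ℝ} (hβ : 0 < β) :
    ∫ x, |a₀ x / a₁ x - 1| * φ x ∂mu ≤ β⁻¹ * ∫ x, |a₀ x / a₁ x - 1| * (1 + β * φ x) ∂mu := by
  have h1 := H.integrable_abs_div_sub_one hc hC h₀ h₁
  have h2 := H.integrable_abs_div_sub_one' hc hC h₀ h₁
  rw [← integral_const_mul]
  refine integral_mono h1 ?_ fun x => ?_
  · refine ((h2.const_mul β⁻¹).add h1).congr ?_
    filter_upwards with x
    simp only [Pi.add_apply]
    field_simp
  · have : β⁻¹ * (|a₀ x / a₁ x - 1| * (1 + β * φ x))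
        = β⁻¹ * |a₀ x / a₁ x - 1| + |a₀ x / a₁ x - 1| * φ x := by field_simp
    simp only [this]
    have : 0 ≤ β⁻¹ * |a₀ x / a₁ x - 1| := by positivity
    linarith

/-- One Sinkhorn update contracts the weighted distance between successive marginals. -/
theorem Admissible.contraction_scaling (H : Admissible mu eta W φ ψ) (hcX : 0 < cX)
    (hcY : 0 < cY) (hCX : 0 < CX) (hCY : 0 < CY) :
    ∃ β₀ > 0, ∀ β, 0 < β → β ≤ β₀ → ∃ ρ, 0 < ρ ∧ ρ < 1 ∧ ∀ a₀ b₁ a₁ b₂,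
      b₁ = scaling (flip W) mu a₀ → a₁ = scaling W eta b₁ → b₂ = scaling (flip W) mu a₁ →
      Band (expCost W eta) cX CX a₀ → Band (expCost (flip W) mu) cY CY b₁ →
      Band (expCost W eta) cX CX a₁ →
      ∫ y, |b₁ y / b₂ y - 1| * (1 + β * ψ y) ∂eta
        ≤ ρ * ∫ x, |a₀ x / a₁ x - 1| * (1 + β * φ x) ∂mu := by
  obtain ⟨β₀, hβ₀, h⟩ := H.contraction hcX hcY hCX hCY
  refine ⟨β₀, hβ₀, fun β hβ hβle => ?_⟩
  obtain ⟨ρ, hρ0, hρ1, hρ⟩ := h β hβ hβle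
  refine ⟨ρ, hρ0, hρ1, ?_⟩
  intro a₀ b₁ a₁ b₂ hb₁ ha₁ hb₂ hA₀ hB₁ hA₁
  have hGX := H.integrable_expCost
  have hb₁i := H.integrable_kernel_mul (hB₁.integrable hcY H.swap.integrable_expCost)
  have ha₀i : ∀ y, Integrable (fun x => Real.exp (-W x y) * a₀ x) mu := H.swap.integrable_kernel_mul (hA₀.integrable hcX hGX)
  have ha₁i : ∀ y, Integrable (fun x => Real.exp (-W x y) * a₁ x) mu := H.swap.integrable_kernel_mul (hA₁.integrable hcX hGX)
  have h1 : ∀ x, a₁ x * ∫ y, Real.exp (-W x y) * b₁ y ∂eta = 1 := fun x => by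
    rw [ha₁]; exact scaling_mul (hB₁.pos hcY) (hb₁i x)
  have e0 : ∀ y, ∫ x, Real.exp (-W x y) * a₀ x ∂mu = (b₁ y)⁻¹ := fun y => by
    rw [hb₁, scaling, inv_inv]; rfl
  have e1 : ∀ y, ∫ x, Real.exp (-W x y) * a₁ x ∂mu = (b₂ y)⁻¹ := fun y => by
    rw [hb₂, scaling, inv_inv]; rfl
  have hdi : Integrable (fun x => a₀ x / a₁ x) mu := by
    rw [ha₁, hb₁]
    exact integrable_div_scaling H.swap.measurable_cost hA₀.meas (hA₀.pos hcX) ha₀i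
  have hd1 : ∫ x, a₀ x / a₁ x ∂mu = 1 := by
    rw [ha₁, hb₁]
    exact integral_div_scaling H.swap.measurable_cost hA₀.meas (hA₀.pos hcX) ha₀i
  -- The contraction acts on `1 - a₀/a₁`, centred because `a₀/a₁` is a probability density; its
  -- image under the transition is `b₁/b₂ - 1`.
  have key := hρ a₁ b₁ hA₁ hB₁ h1 (fun x => 1 - a₀ x / a₁ x)
    (measurable_const.sub (hA₀.meas.div hA₁.meas))
    (by simpa only [abs_sub_comm] using H.integrable_abs_div_sub_one hcX hCX hA₀ hA₁)
    (by rw [integral_sub (integrable_const 1) hdi, hd1]; simp)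
  have hden : ∀ y, ∫ x, (1 - a₀ x / a₁ x) * (a₁ x * Real.exp (-W x y) * b₁ y) ∂mu
      = b₁ y / b₂ y - 1 := fun y => by
    have : ∀ x, (1 - a₀ x / a₁ x) * (a₁ x * Real.exp (-W x y) * b₁ y)
        = b₁ y * (Real.exp (-W x y) * a₁ x - Real.exp (-W x y) * a₀ x) := fun x => by
      have := (hA₁.pos hcX x).ne'
      field_simp
    simp_rw [this]
    rw [integral_const_mul, integral_sub (ha₁i y) (ha₀i y), e0, e1, mul_sub,
      mul_inv_cancel₀ (hB₁.pos hcY y).ne', div_eq_mul_inv]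
  simp_rw [hden] at key
  simpa only [abs_sub_comm (1 : ℝ)] using key

/-- The integral smooths: the reciprocals of `a₀`, `a₁` differ uniformly in `x` by a weighted `L¹`
distance, and passing to logarithms costs one factor of size `φ`. -/
theorem Admissible.abs_log_scaling_sub_le (H : Admissible mu eta W φ ψ) (hcX : 0 < cX)
    (hcY : 0 < cY) (hCX : 0 < CX) (hCY : 0 < CY) :
    ∃ C > 0, ∀ b₀ b₁ a₀ a₁, a₀ = scaling W eta b₀ → a₁ = scaling W eta b₁ →
      Band (expCost (flip W) mu) cY CY b₀ → Band (expCost (flip W) mu) cY CY b₁ →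
      Band (expCost W eta) cX CX a₀ → Band (expCost W eta) cX CX a₁ →
      ∀ x, |Real.log (a₁ x) - Real.log (a₀ x)| ≤ C * φ x * ∫ y, |b₀ y / b₁ y - 1| * ψ y ∂eta := by
  obtain ⟨M, hM, hKM⟩ := H.exists_kernel_le
  obtain ⟨DX, hDX, hφ⟩ := H.exists_expCost_le
  obtain ⟨DY, hDY, hψ⟩ := H.swap.exists_expCost_le
  refine ⟨CX * DX * (M * (CY * DY)), by positivity, ?_⟩
  intro b₀ b₁ a₀ a₁ ha₀ ha₁ hB₀ hB₁ hA₀ hA₁ x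
  have hi₀ := H.integrable_kernel_mul (hB₀.integrable hcY H.swap.integrable_expCost)
  have hi₁ := H.integrable_kernel_mul (hB₁.integrable hcY H.swap.integrable_expCost)
  have hdi := H.swap.integrable_abs_div_sub_one hcY hCY hB₀ hB₁
  set I := ∫ y, |b₀ y / b₁ y - 1| * ψ y ∂eta with hI
  have hI0 : 0 ≤ I := integral_nonneg fun y => mul_nonneg (abs_nonneg _) (H.right_pos y).le
  have e0 : ∫ y, Real.exp (-W x y) * b₀ y ∂eta = (a₀ x)⁻¹ := by
    rw [ha₀, scaling, inv_inv]
  have e1 : ∫ y, Real.exp (-W x y) * b₁ y ∂eta = (a₁ x)⁻¹ := by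
    rw [ha₁, scaling, inv_inv]
  have hZ : |(a₀ x)⁻¹ - (a₁ x)⁻¹| ≤ M * (CY * DY) * I := by
    rw [← e0, ← e1, ← integral_sub (hi₀ x) (hi₁ x)]
    refine (abs_integral_le_integral_abs).trans ?_
    rw [hI, ← integral_const_mul]
    refine integral_mono_of_nonneg (Filter.Eventually.of_forall fun y => abs_nonneg _)
      (hdi.const_mul _) (Filter.Eventually.of_forall fun y => ?_)
    have hb₁ := hB₁.pos hcY y
    have h1 : Real.exp (-W x y) * b₀ y - Real.exp (-W x y) * b₁ y
        = Real.exp (-W x y) * (b₁ y * (b₀ y / b₁ y - 1)) := by field_simp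
    simp only
    rw [h1, abs_mul, abs_mul, abs_of_pos (Real.exp_pos _), abs_of_pos hb₁]
    have h2 : b₁ y ≤ CY * DY * ψ y := by
      calc b₁ y ≤ CY * expCost (flip W) mu y := hB₁.upper y
        _ ≤ CY * (DY * ψ y) := mul_le_mul_of_nonneg_left (hψ y) hCY.le
        _ = _ := by ring
    calc Real.exp (-W x y) * (b₁ y * |b₀ y / b₁ y - 1|)
        ≤ M * (CY * DY * ψ y * |b₀ y / b₁ y - 1|) :=
          mul_le_mul (hKM x y) (mul_le_mul_of_nonneg_right h2 (abs_nonneg _))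
            (by positivity) hM.le
      _ = _ := by ring
  have hbound : ∀ a, Band (expCost W eta) cX CX a →
      a x * |(a₀ x)⁻¹ - (a₁ x)⁻¹| ≤ CX * DX * (M * (CY * DY)) * φ x * I := fun a hA => by
    have : a x ≤ CX * DX * φ x := by
      calc a x ≤ CX * expCost W eta x := hA.upper x
        _ ≤ CX * (DX * φ x) := mul_le_mul_of_nonneg_left (hφ x) hCX.le
        _ = _ := by ring
    calc a x * |(a₀ x)⁻¹ - (a₁ x)⁻¹| ≤ CX * DX * φ x * (M * (CY * DY) * I) :=
          mul_le_mul this hZ (abs_nonneg _) (by have := H.left_pos x; positivity)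
      _ = _ := by ring
  have p0 := hA₀.pos hcX x
  have p1 := hA₁.pos hcX x
  -- The right-hand side equals `s/t - 1`.
  have hle : ∀ s t : ℝ, 0 < s → 0 < t → Real.log s - Real.log t ≤ s * (t⁻¹ - s⁻¹) :=
    fun s t hs ht => by
      rw [← Real.log_div hs.ne' ht.ne', mul_sub, mul_inv_cancel₀ hs.ne', ← div_eq_mul_inv]
      exact Real.log_le_sub_one_of_pos (div_pos hs ht)
  rw [abs_sub_le_iff]
  constructor
  · refine (hle _ _ p1 p0).trans (le_trans ?_ (hbound a₁ hA₁))
    exact mul_le_mul_of_nonneg_left (le_abs_self _) p1.le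
  · refine (hle _ _ p0 p1).trans (le_trans ?_ (hbound a₀ hA₀))
    rw [abs_sub_comm]
    exact mul_le_mul_of_nonneg_left (le_abs_self _) p0.le

/-- Geometric convergence of the Sinkhorn iteration. -/
theorem Admissible.geometric (H : Admissible mu eta W φ ψ) {V : Y → ℝ} (hcX : 0 < cX)
    (hcY : 0 < cY) (hCX : 0 < CX) (hCY : 0 < CY)
    (hband : ∀ n, Band (expCost W eta) cX CX (potX mu eta W V n) ∧
      Band (expCost (flip W) mu) cY CY (potY mu eta W V (n + 1))) :
    ∃ ρ, 0 < ρ ∧ ρ < 1 ∧ ∃ C > 0, ∀ n,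
      ∫ x, |potX mu eta W V (n + 1) x / potX mu eta W V (n + 2) x - 1| * φ x ∂mu ≤ C * ρ ^ n ∧
      ∫ y, |potY mu eta W V (n + 1) y / potY mu eta W V (n + 2) y - 1| * ψ y ∂eta ≤ C * ρ ^ n ∧
      (∀ x, |Real.log (potX mu eta W V (n + 2) x) - Real.log (potX mu eta W V (n + 1) x)|
        ≤ C * φ x * ρ ^ n) ∧
      (∀ y, |Real.log (potY mu eta W V (n + 2) y) - Real.log (potY mu eta W V (n + 1) y)|
        ≤ C * ψ y * ρ ^ n) := by
  obtain ⟨β₁, hβ₁, hc₁⟩ := H.contraction_scaling hcX hcY hCX hCY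
  obtain ⟨β₂, hβ₂, hc₂⟩ := H.swap.contraction_scaling hcY hcX hCY hCX
  set β := min β₁ β₂ with hβdef
  have hβ : 0 < β := lt_min hβ₁ hβ₂
  obtain ⟨ρ₁, h10, h11, hρ₁⟩ := hc₁ β hβ (min_le_left _ _)
  obtain ⟨ρ₂, h20, h21, hρ₂⟩ := hc₂ β hβ (min_le_right _ _)
  obtain ⟨LX, hLX, hlogX⟩ := H.abs_log_scaling_sub_le hcX hcY hCX hCY
  obtain ⟨LY, hLY, hlogY⟩ := H.swap.abs_log_scaling_sub_le hcY hcX hCY hCX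
  have hA := fun n => (hband n).1
  have hB := fun n => (hband n).2
  set a := potX mu eta W V with ha
  set b := potY mu eta W V with hb
  set E : ℕ → ℝ := fun n => ∫ x, |a n x / a (n + 1) x - 1| * (1 + β * φ x) ∂mu with hE
  set D : ℕ → ℝ := fun n => ∫ y, |b n y / b (n + 1) y - 1| * (1 + β * ψ y) ∂eta with hD
  have hE0 : ∀ n, 0 ≤ E n := fun n => integral_nonneg fun x =>
    mul_nonneg (abs_nonneg _) (by have := mul_pos hβ (H.left_pos x); linarith)
  have hD0 : ∀ n, 0 ≤ D n := fun n => integral_nonneg fun y =>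
    mul_nonneg (abs_nonneg _) (by have := mul_pos hβ (H.right_pos y); linarith)
  -- Indices of `D` start at one because `potY` at index zero is `e^V`, outside the band.
  have hDE : ∀ n, D (n + 1) ≤ ρ₁ * E n := fun n =>
    hρ₁ (a n) (b (n + 1)) (a (n + 1)) (b (n + 2)) rfl rfl rfl (hA n) (hB n) (hA (n + 1))
  have hED : ∀ n, E (n + 1) ≤ ρ₂ * D (n + 1) := fun n =>
    hρ₂ (b (n + 1)) (a (n + 1)) (b (n + 2)) (a (n + 2)) rfl rfl rfl (hB n) (hA (n + 1)) (hB (n + 1))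
  -- One of the two half-steps is used only as a non-expansion; the rate per full round is `ρ₂`.
  have hDle : ∀ n, D (n + 1) ≤ E n := fun n => (hDE n).trans (by nlinarith [hE0 n])
  have hEn : ∀ n, E n ≤ E 0 * ρ₂ ^ n := by
    intro n
    induction n with
    | zero => simp
    | succ n ih =>
      calc E (n + 1) ≤ ρ₂ * D (n + 1) := hED n
        _ ≤ ρ₂ * (E 0 * ρ₂ ^ n) := mul_le_mul_of_nonneg_left ((hDle n).trans ih) h20.le
        _ = _ := by ring
  have hφE : ∀ n, ∫ x, |a n x / a (n + 1) x - 1| * φ x ∂mu ≤ β⁻¹ * E 0 * ρ₂ ^ n := fun n => by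
    refine (H.integral_mul_le_weighted hcX hCX (hA n) (hA (n + 1)) hβ).trans ?_
    rw [mul_assoc]
    exact mul_le_mul_of_nonneg_left (hEn n) (inv_pos.2 hβ).le
  have hψD : ∀ n, ∫ y, |b (n + 1) y / b (n + 2) y - 1| * ψ y ∂eta ≤ β⁻¹ * E 0 * ρ₂ ^ n :=
    fun n => by
      refine (H.swap.integral_mul_le_weighted hcY hCY (hB n) (hB (n + 1)) hβ).trans ?_
      rw [mul_assoc]
      exact mul_le_mul_of_nonneg_left ((hDle n).trans (hEn n)) (inv_pos.2 hβ).le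
  set T := β⁻¹ * E 0 with hT
  have hT0 : 0 ≤ T := mul_nonneg (inv_pos.2 hβ).le (hE0 0)
  -- The summand `1` only keeps the constant positive when the initial error vanishes.
  refine ⟨ρ₂, h20, h21, (1 + LX + LY) * T + 1, by positivity, fun n => ?_⟩
  have hpow : 0 < ρ₂ ^ n := pow_pos h20 n
  have hTle : T ≤ (1 + LX + LY) * T + 1 := by nlinarith
  refine ⟨(hφE (n + 1)).trans ?_, (hψD n).trans (mul_le_mul_of_nonneg_right hTle hpow.le),
    fun x => ?_, fun y => ?_⟩
  · refine mul_le_mul hTle ?_ (by positivity) (by positivity)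
    exact pow_le_pow_of_le_one h20.le h21.le (Nat.le_succ n)
  · refine (hlogX (b (n + 1)) (b (n + 2)) (a (n + 1)) (a (n + 2)) rfl rfl (hB n) (hB (n + 1))
      (hA (n + 1)) (hA (n + 2)) x).trans ?_
    have h0 := H.left_pos x
    calc LX * φ x * ∫ y, |b (n + 1) y / b (n + 2) y - 1| * ψ y ∂eta
        ≤ LX * φ x * (T * ρ₂ ^ n) := mul_le_mul_of_nonneg_left (hψD n) (by positivity)
      _ = LX * T * (φ x * ρ₂ ^ n) := by ring
      _ ≤ ((1 + LX + LY) * T + 1) * (φ x * ρ₂ ^ n) :=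
          mul_le_mul_of_nonneg_right (by nlinarith) (by positivity)
      _ = _ := by ring
  · refine (hlogY (a n) (a (n + 1)) (b (n + 1)) (b (n + 2)) rfl rfl (hA n) (hA (n + 1))
      (hB n) (hB (n + 1)) y).trans ?_
    have h0 := H.right_pos y
    calc LY * ψ y * ∫ x, |a n x / a (n + 1) x - 1| * φ x ∂mu
        ≤ LY * ψ y * (T * ρ₂ ^ n) := mul_le_mul_of_nonneg_left (hφE n) (by positivity)
      _ = LY * T * (ψ y * ρ₂ ^ n) := by ring
      _ ≤ ((1 + LX + LY) * T + 1) * (ψ y * ρ₂ ^ n) :=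
          mul_le_mul_of_nonneg_right (by nlinarith) (by positivity)
      _ = _ := by ring

end Convergence

/-! ### Limits of the scaling functions and the Schrödinger system -/

section Limit

open Filter Topology

variable {X Y : Type*} [MeasurableSpace X] [MeasurableSpace Y]
  {mu : Measure X} [IsProbabilityMeasure mu] {eta : Measure Y} [IsProbabilityMeasure eta]
  {W : X → Y → ℝ} {φ : X → ℝ} {ψ : Y → ℝ} {cX CX cY CY : ℝ}

/-- The logarithms form a Cauchy sequence with geometric increments at each point; the tail sum
gives the factor `1/(1 - ρ)`. -/
theorem exists_band_limit {G : X → ℝ} {c C L ρ : ℝ} (hc : 0 < c) (hρ1 : ρ < 1) {a : ℕ → X → ℝ}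
    (ha : ∀ n, Band G c C (a n))
    (hlog : ∀ n x, |Real.log (a (n + 1) x) - Real.log (a n x)| ≤ L * φ x * ρ ^ n) :
    ∃ a', Band G c C a' ∧ (∀ x, Tendsto (fun n => a n x) atTop (𝓝 (a' x))) ∧
      ∀ n x, |Real.log (a' x) - Real.log (a n x)| ≤ L * φ x * ρ ^ n / (1 - ρ) := by
  have hd : ∀ x n, dist (Real.log (a n x)) (Real.log (a (n + 1) x)) ≤ L * φ x * ρ ^ n :=
    fun x n => by rw [dist_comm, Real.dist_eq]; exact hlog n x
  have hlim := fun x => cauchySeq_tendsto_of_complete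
    (cauchySeq_of_le_geometric ρ (L * φ x) hρ1 (hd x))
  choose l hl using hlim
  have hlim : ∀ x, Tendsto (fun n => a n x) atTop (𝓝 (Real.exp (l x))) := fun x => by
    refine ((Real.continuous_exp.tendsto (l x)).comp (hl x)).congr fun n => ?_
    exact Real.exp_log ((ha n).pos hc x)
  refine ⟨fun x => Real.exp (l x), ⟨?_, fun x => ?_, fun x => ?_⟩, hlim, fun n x => ?_⟩
  · exact measurable_of_tendsto_metrizable (fun n => (ha n).meas) (tendsto_pi_nhds.2 hlim)
  · exact ge_of_tendsto' (hlim x) fun n => (ha n).lower x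
  · exact le_of_tendsto' (hlim x) fun n => (ha n).upper x
  · have := dist_le_of_le_geometric_of_tendsto ρ (L * φ x) hρ1 (hd x) (hl x) n
    rw [dist_comm, Real.dist_eq] at this
    simpa using this

/-- Dominated convergence: the upper edge of the band is an integrable envelope independent of `n`.
-/
theorem Admissible.tendsto_scaling (H : Admissible mu eta W φ ψ) (hcY : 0 < cY)
    {b : ℕ → Y → ℝ} {b' : Y → ℝ} (hb : ∀ n, Band (expCost (flip W) mu) cY CY (b n))
    (hb' : Band (expCost (flip W) mu) cY CY b')
    (hlim : ∀ y, Tendsto (fun n => b n y) atTop (𝓝 (b' y))) (x : X) :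
    Tendsto (fun n => scaling W eta (b n) x) atTop (𝓝 (scaling W eta b' x)) := by
  have hG := H.swap.integrable_expCost
  have hi := H.integrable_kernel_mul (hb'.integrable hcY hG) x
  have hne := (integral_pos_of_forall_pos hi
    fun y => mul_pos (Real.exp_pos _) (hb'.pos hcY y)).ne'
  refine Tendsto.inv₀ ?_ hne
  have hdom := H.integrable_kernel_mul (hG.const_mul CY) x
  refine tendsto_integral_of_dominated_convergence _ (fun n => ?_) hdom (fun n => ?_) ?_
  · exact (H.integrable_kernel_mul ((hb n).integrable hcY hG) x).aestronglyMeasurable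
  · filter_upwards with y
    rw [Real.norm_eq_abs, abs_of_pos (mul_pos (Real.exp_pos _) ((hb n).pos hcY y))]
    exact mul_le_mul_of_nonneg_left ((hb n).upper y) (Real.exp_pos _).le
  · filter_upwards with y
    exact (hlim y).const_mul _

/-- The Sinkhorn scaling functions converge geometrically to a solution of the Schrödinger
system. -/
theorem Admissible.exists_fixedPoint (H : Admissible mu eta W φ ψ) {V : Y → ℝ} (hcX : 0 < cX)
    (hcY : 0 < cY)
    (hband : ∀ n, Band (expCost W eta) cX CX (potX mu eta W V n) ∧
      Band (expCost (flip W) mu) cY CY (potY mu eta W V (n + 1)))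
    {ρ C : ℝ} (hρ1 : ρ < 1)
    (hX : ∀ n x, |Real.log (potX mu eta W V (n + 2) x) - Real.log (potX mu eta W V (n + 1) x)|
        ≤ C * φ x * ρ ^ n)
    (hY : ∀ n y, |Real.log (potY mu eta W V (n + 2) y) - Real.log (potY mu eta W V (n + 1) y)|
        ≤ C * ψ y * ρ ^ n) :
    ∃ a b, Band (expCost W eta) cX CX a ∧ Band (expCost (flip W) mu) cY CY b ∧
      a = scaling W eta b ∧ b = scaling (flip W) mu a ∧
      (∀ n x, |Real.log (a x) - Real.log (potX mu eta W V (n + 1) x)|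
        ≤ C * φ x * ρ ^ n / (1 - ρ)) ∧
      (∀ n y, |Real.log (b y) - Real.log (potY mu eta W V (n + 1) y)|
        ≤ C * ψ y * ρ ^ n / (1 - ρ)) := by
  obtain ⟨a, ha, hla, hCa⟩ := exists_band_limit (a := fun n => potX mu eta W V (n + 1)) hcX hρ1
    (fun n => (hband (n + 1)).1) hX
  obtain ⟨b, hb, hlb, hCb⟩ := exists_band_limit (a := fun n => potY mu eta W V (n + 1)) hcY hρ1
    (fun n => (hband n).2) hY
  refine ⟨a, b, ha, hb, ?_, ?_, hCa, hCb⟩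
  · ext x
    exact tendsto_nhds_unique (hla x) (H.tendsto_scaling hcY (fun n => (hband n).2) hb hlb x)
  · ext y
    exact tendsto_nhds_unique ((hlb y).comp (tendsto_add_atTop_nat 1))
      (H.swap.tendsto_scaling hcX (fun n => (hband (n + 1)).1) ha hla y)

end Limit

/-! ### Identification of the Sinkhorn kernels with the scaling functions -/

section Density

variable {X Y : Type*} [MeasurableSpace X] [MeasurableSpace Y]

theorem map_swap_withDensity {m : Measure (X × Y)} {d : X × Y → ℝ≥0∞} (hd : Measurable d) :
    (m.withDensity d).map Prod.swap = (m.map Prod.swap).withDensity (fun z => d z.swap) := by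
  ext s hs
  rw [Measure.map_apply measurable_swap hs, withDensity_apply _ (measurable_swap hs),
    withDensity_apply _ hs, setLIntegral_map (f := fun z : Y × X => d z.swap) hs
      (hd.comp measurable_swap) measurable_swap]
  simp

theorem map_snd_withDensity_prod {m : Measure X} {m' : Measure Y} [SFinite m] [SFinite m']
    {d : X × Y → ℝ≥0∞} (hd : Measurable d) :
    ((m.prod m').withDensity d).map Prod.snd = m'.withDensity (fun y => ∫⁻ x, d (x, y) ∂m) := by
  ext s hs
  rw [Measure.map_apply measurable_snd hs, withDensity_apply _ (measurable_snd hs),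
    withDensity_apply _ hs, ← lintegral_indicator (measurable_snd hs), ← lintegral_indicator hs,
    lintegral_prod_symm' _ (hd.indicator (measurable_snd hs))]
  refine lintegral_congr fun y => ?_
  by_cases hy : y ∈ s <;> simp [indicator, hy]

theorem withDensity_compProd {m : Measure X} [SFinite m] {f : X → ℝ≥0∞} (hf : Measurable f)
    [SFinite (m.withDensity f)] (κ : Kernel X Y) [IsSFiniteKernel κ] :
    (m.withDensity f) ⊗ₘ κ = (m ⊗ₘ κ).withDensity (fun z => f z.1) := by
  ext s hs
  rw [withDensity_apply _ hs, ← lintegral_indicator hs,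
    Measure.lintegral_compProd (f := s.indicator fun z => f z.1)
      ((hf.comp measurable_fst).indicator hs), Measure.compProd_apply hs,
    lintegral_withDensity_eq_lintegral_mul _ hf (Kernel.measurable_kernel_prodMk_left hs)]
  refine lintegral_congr fun x => ?_
  have : ∀ y, s.indicator (fun z : X × Y => f z.1) (x, y)
      = (Prod.mk x ⁻¹' s).indicator (fun _ => f x) y := fun y => by
    by_cases hy : (x, y) ∈ s <;> simp [indicator, hy]
  simp_rw [this]
  rw [lintegral_indicator_const (measurable_prodMk_left hs)]
  rfl

/-- The Bochner integral of a non-integrable function is zero by convention, so the normalization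
already contains integrability. -/
theorem integrable_of_mul_integral_eq_one {m : Measure X} {f : X → ℝ} {c : ℝ}
    (h : c * ∫ x, f x ∂m = 1) : Integrable f m := by
  by_contra hf
  rw [integral_undef hf, mul_zero] at h
  exact zero_ne_one h

section Posterior

variable {m : Measure X} [IsProbabilityMeasure m] {m' : Measure Y} [IsProbabilityMeasure m']
  {κ : Kernel X Y} [IsMarkovKernel κ] {k : X → Y → ℝ} {a : X → ℝ} {b b' : Y → ℝ}

theorem measurable_density (hk : Measurable (Function.uncurry k)) (ha : Measurable a)
    (hb : Measurable b) :
    Measurable fun z : X × Y => ENNReal.ofReal (a z.1 * k z.1 z.2 * b z.2) :=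
  (((ha.comp measurable_fst).mul hk).mul (hb.comp measurable_snd)).ennreal_ofReal

theorem comp_eq_withDensity (hk : Measurable (Function.uncurry k)) (hk0 : ∀ x y, 0 ≤ k x y)
    (ha : Measurable a) (hb : Measurable b) (ha0 : ∀ x, 0 < a x) (hb0 : ∀ y, 0 < b y)
    (hb' : ∀ y, b' y * ∫ x, k x y * a x ∂m = 1)
    (h : m ⊗ₘ κ = (m.prod m').withDensity
      (fun z => ENNReal.ofReal (a z.1 * k z.1 z.2 * b z.2))) :
    κ ∘ₘ m = m'.withDensity (fun y => ENNReal.ofReal (b y / b' y)) := by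
  rw [← Measure.snd_compProd, h, Measure.snd,
    map_snd_withDensity_prod (measurable_density hk ha hb)]
  congr 1
  ext y
  have hi := integrable_of_mul_integral_eq_one (hb' y)
  have hb'0 : b' y ≠ 0 := left_ne_zero_of_mul_eq_one (hb' y)
  have e : ∀ x, a x * k x y * b y = k x y * a x * b y := fun x => by ring
  simp_rw [e]
  rw [← ofReal_integral_eq_lintegral_ofReal (hi.mul_const _)
    (Filter.Eventually.of_forall fun x =>
      mul_nonneg (mul_nonneg (hk0 x y) (ha0 x).le) (hb0 y).le), integral_mul_const]
  congr 1
  rw [eq_div_iff hb'0]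
  linear_combination b y * hb' y

/-- Conditioning on the second variable fixes the transition and replacing its marginal by `m'`
divides the joint density by `b/b'`: exactly the update from `b` to `b'`. -/
theorem compProd_posterior_eq_withDensity [StandardBorelSpace X] [Nonempty X]
    (hk : Measurable (Function.uncurry k)) (hk0 : ∀ x y, 0 ≤ k x y)
    (ha : Measurable a) (hb : Measurable b) (ha0 : ∀ x, 0 < a x) (hb0 : ∀ y, 0 < b y)
    (hbm' : Measurable b') (hb'0 : ∀ y, 0 < b' y) (hb' : ∀ y, b' y * ∫ x, k x y * a x ∂m = 1)
    (h : m ⊗ₘ κ = (m.prod m').withDensity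
      (fun z => ENNReal.ofReal (a z.1 * k z.1 z.2 * b z.2))) :
    m' ⊗ₘ (κ†m) = (m'.prod m).withDensity
      (fun z => ENNReal.ofReal (b' z.1 * flip k z.1 z.2 * a z.2)) := by
  have hcomp := comp_eq_withDensity hk hk0 ha hb ha0 hb0 hb' h
  have hq : Measurable fun y => ENNReal.ofReal (b y / b' y) := (hb.div hbm').ennreal_ofReal
  have hqpos : ∀ y, 0 < b y / b' y := fun y => div_pos (hb0 y) (hb'0 y)
  -- The marginal density is positive, so `m'` is recovered from the marginal by the inverse
  -- density, and the defining identity of the posterior becomes applicable.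
  have hinv : m' = (κ ∘ₘ m).withDensity (fun y => (ENNReal.ofReal (b y / b' y))⁻¹) := by
    rw [hcomp]
    exact (withDensity_inv_same hq
      (Filter.Eventually.of_forall fun y => (ENNReal.ofReal_pos.2 (hqpos y)).ne')
      (Filter.Eventually.of_forall fun y => ENNReal.ofReal_ne_top)).symm
  have hd := measurable_density hk ha hb
  have hcongr : m' ⊗ₘ (κ†m)
      = ((κ ∘ₘ m).withDensity (fun y => (ENNReal.ofReal (b y / b' y))⁻¹)) ⊗ₘ (κ†m) := by
    rw [← hinv]
  have hqi : Measurable fun y => (ENNReal.ofReal (b y / b' y))⁻¹ := hq.inv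
  have hqi' : Measurable fun z : Y × X => (ENNReal.ofReal (b z.1 / b' z.1))⁻¹ :=
    hqi.comp measurable_fst
  have hd' : Measurable fun z : Y × X =>
      ENNReal.ofReal (a z.swap.1 * k z.swap.1 z.swap.2 * b z.swap.2) := hd.comp measurable_swap
  rw [hcongr, withDensity_compProd hqi, compProd_posterior_eq_map_swap, h,
    map_swap_withDensity hd, Measure.prod_swap, ← withDensity_mul _ hd' hqi']
  congr 1
  ext z
  simp only [Pi.mul_apply, Prod.fst_swap, Prod.snd_swap, flip]
  rw [← ENNReal.ofReal_inv_of_pos (hqpos _), ← ENNReal.ofReal_mul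
    (mul_nonneg (mul_nonneg (ha0 _).le (hk0 _ _)) (hb0 _).le)]
  congr 1
  have := (hb0 z.1).ne'
  have := (hb'0 z.1).ne'
  field_simp

end Posterior

section Iterates

variable {mu : Measure X} [IsProbabilityMeasure mu] {eta : Measure Y} [IsProbabilityMeasure eta]
  {W : X → Y → ℝ} {φ : X → ℝ} {ψ : Y → ℝ} {V : Y → ℝ}

/-- The measure with density `a(x) e^{-W(x,y)} b(y)` with respect to `μ ⊗ η`. -/
noncomputable def scaledMeasure (mu : Measure X) (eta : Measure Y) (W : X → Y → ℝ) (a : X → ℝ)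
    (b : Y → ℝ) : Measure (X × Y) :=
  (mu.prod eta).withDensity (fun z => ENNReal.ofReal (a z.1 * Real.exp (-W z.1 z.2) * b z.2))

/-- Since `ν = e^V ν_V`, the initial scaling functions are `1` and `e^V`. -/
theorem compProd_refKernel {nu : Measure Y} [SFinite nu] [IsProbabilityMeasure (gibbs nu V)]
    (hW : Measurable (Function.uncurry W)) (hV : Measurable V) [IsMarkovKernel (refKernel W nu)] :
    mu ⊗ₘ refKernel W nu
      = scaledMeasure mu (gibbs nu V) W (fun _ => 1) (fun y => Real.exp (V y)) := by
  have hm : Measurable (Function.uncurry fun x y => ENNReal.ofReal (Real.exp (-W x y))) :=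
    (hW.neg.exp).ennreal_ofReal
  have hinst : IsSFiniteKernel (Kernel.withDensity (Kernel.const X nu)
      fun x y => ENNReal.ofReal (Real.exp (-W x y))) :=
    inferInstanceAs (IsSFiniteKernel (refKernel W nu))
  have hinst2 : SFinite (nu.withDensity fun y => ENNReal.ofReal (Real.exp (-V y))) :=
    inferInstanceAs (SFinite (gibbs nu V))
  have hVm : Measurable fun y => ENNReal.ofReal (Real.exp (-V y)) := hV.neg.exp.ennreal_ofReal
  have hVm' : Measurable fun z : X × Y => ENNReal.ofReal (Real.exp (-V z.2)) :=
    hVm.comp measurable_snd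
  rw [refKernel, Measure.compProd_withDensity hm, Measure.compProd_const, scaledMeasure, gibbs,
    prod_withDensity_right hVm, ← withDensity_mul _ hVm'
    (measurable_density (k := fun x y => Real.exp (-W x y)) hW.neg.exp measurable_const hV.exp)]
  congr 1
  ext z
  simp only [Pi.mul_apply]
  rw [← ENNReal.ofReal_mul (Real.exp_pos _).le]
  congr 1
  rw [one_mul, mul_left_comm, ← Real.exp_add]
  simp

theorem normalized_gibbs {nu : Measure Y} [SFinite nu] [IsProbabilityMeasure (gibbs nu V)]
    (hW : Measurable (Function.uncurry W)) (hV : Measurable V) [IsMarkovKernel (refKernel W nu)]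
    (hVi : Integrable V (gibbs nu V)) : Normalized (gibbs nu V) W V := by
  have hm : Measurable (Function.uncurry fun x y => ENNReal.ofReal (Real.exp (-W x y))) :=
    (hW.neg.exp).ennreal_ofReal
  have hVm : Measurable fun y => ENNReal.ofReal (Real.exp (-V y)) := hV.neg.exp.ennreal_ofReal
  have hmx : ∀ x, Measurable fun y => Real.exp (-W x y) * Real.exp (V y) := fun x =>
    ((hW.comp measurable_prodMk_left).neg.exp).mul hV.exp
  have hl : ∀ x, ∫⁻ y, ENNReal.ofReal (Real.exp (-W x y) * Real.exp (V y)) ∂(gibbs nu V) = 1 :=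
    fun x => by
      have h1 : refKernel W nu x univ = 1 := measure_univ
      rw [refKernel, Kernel.withDensity_apply _ hm, withDensity_apply _ MeasurableSet.univ,
        Kernel.const_apply, Measure.restrict_univ] at h1
      rw [gibbs, lintegral_withDensity_eq_lintegral_mul _ hVm (hmx x).ennreal_ofReal, ← h1]
      refine lintegral_congr fun y => ?_
      simp only [Pi.mul_apply]
      rw [← ENNReal.ofReal_mul (Real.exp_pos _).le, mul_left_comm, ← Real.exp_add]
      simp
  have hi : ∀ x, Integrable (fun y => Real.exp (-W x y) * Real.exp (V y)) (gibbs nu V) :=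
    fun x => by
      refine ⟨(hmx x).aestronglyMeasurable, ?_⟩
      rw [hasFiniteIntegral_iff_ofReal (Filter.Eventually.of_forall fun y =>
        (mul_pos (Real.exp_pos _) (Real.exp_pos _)).le), hl x]
      exact ENNReal.one_lt_top
  refine ⟨hV, hVi, hi, fun x => ?_⟩
  have h2 := ofReal_integral_eq_lintegral_ofReal (hi x) (Filter.Eventually.of_forall fun y =>
    (mul_pos (Real.exp_pos (-W x y)) (Real.exp_pos (V y))).le)
  rw [hl x] at h2
  exact ENNReal.ofReal_eq_one.1 h2

variable [StandardBorelSpace X] [Nonempty X] [StandardBorelSpace Y] [Nonempty Y]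
  {Q : Kernel X Y} [IsMarkovKernel Q]

/-- The scaling functions are positive and measurable, and the integrals defining the updates
converge. -/
structure Regular (mu : Measure X) (eta : Measure Y) (W : X → Y → ℝ) (V : Y → ℝ) : Prop where
  meas_cost : Measurable (Function.uncurry W)
  measX : ∀ n, Measurable (potX mu eta W V n)
  measY : ∀ n, Measurable (potY mu eta W V n)
  posX : ∀ n x, 0 < potX mu eta W V n x
  posY : ∀ n y, 0 < potY mu eta W V n y
  mulX : ∀ n x, potX mu eta W V n x * ∫ y, Real.exp (-W x y) * potY mu eta W V n y ∂eta = 1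
  mulY : ∀ n y, potY mu eta W V (n + 1) y * ∫ x, Real.exp (-W x y) * potX mu eta W V n x ∂mu = 1

namespace Regular

variable (R : Regular mu eta W V)
include R

theorem compProd_oddKernel {n : ℕ}
    (h : evenBridge mu eta Q n = scaledMeasure mu eta W (potX mu eta W V n) (potY mu eta W V n)) :
    eta ⊗ₘ oddKernel mu eta Q n
      = scaledMeasure eta mu (flip W) (potY mu eta W V (n + 1)) (potX mu eta W V n) :=
  compProd_posterior_eq_withDensity (k := fun x y => Real.exp (-W x y)) R.meas_cost.neg.exp
    (fun _ _ => (Real.exp_pos _).le) (R.measX n) (R.measY n) (R.posX n) (R.posY n)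
    (R.measY (n + 1)) (R.posY (n + 1)) (R.mulY n) h

theorem evenBridge_eq (h0 : mu ⊗ₘ Q = scaledMeasure mu eta W (fun _ => 1)
    (fun y => Real.exp (V y))) (h1 : potX mu eta W V 0 = fun _ => 1) (n : ℕ) :
    evenBridge mu eta Q n = scaledMeasure mu eta W (potX mu eta W V n) (potY mu eta W V n) := by
  induction n with
  | zero => rw [h1]; exact h0
  | succ n ih =>
    have h := R.compProd_oddKernel ih
    have : IsMarkovKernel (oddKernel mu eta Q n) :=
      inferInstanceAs (IsMarkovKernel ((evenKernel mu eta Q n)†mu))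
    exact compProd_posterior_eq_withDensity (k := fun y x => Real.exp (-flip W y x))
      (R.meas_cost.comp measurable_swap).neg.exp
      (fun _ _ => (Real.exp_pos _).le) (R.measY (n + 1)) (R.measX n) (R.posY (n + 1)) (R.posX n)
      (R.measX (n + 1)) (R.posX (n + 1)) (R.mulX (n + 1)) h

theorem evenMarginal_eq {n : ℕ}
    (h : evenBridge mu eta Q n = scaledMeasure mu eta W (potX mu eta W V n) (potY mu eta W V n)) :
    evenMarginal mu eta Q n = eta.withDensity
      (fun y => ENNReal.ofReal (potY mu eta W V n y / potY mu eta W V (n + 1) y)) :=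
  comp_eq_withDensity (k := fun x y => Real.exp (-W x y)) R.meas_cost.neg.exp
    (fun _ _ => (Real.exp_pos _).le) (R.measX n) (R.measY n) (R.posX n) (R.posY n)
    (R.mulY n) h

theorem oddMarginal_eq {n : ℕ}
    (h : evenBridge mu eta Q n = scaledMeasure mu eta W (potX mu eta W V n) (potY mu eta W V n)) :
    oddMarginal mu eta Q n = mu.withDensity
      (fun x => ENNReal.ofReal (potX mu eta W V n x / potX mu eta W V (n + 1) x)) := by
  have h := R.compProd_oddKernel h
  have : IsMarkovKernel (oddKernel mu eta Q n) :=
    inferInstanceAs (IsMarkovKernel ((evenKernel mu eta Q n)†mu))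
  exact comp_eq_withDensity (k := fun y x => Real.exp (-flip W y x))
    (R.meas_cost.comp measurable_swap).neg.exp
    (fun _ _ => (Real.exp_pos _).le) (R.measY (n + 1)) (R.measX n) (R.posY (n + 1)) (R.posX n)
    (R.mulX (n + 1)) h

end Regular

end Iterates

end Density

/-! ### Distances to a reference measure by a maximal coupling -/

section Distances

variable {E : Type*} [MeasurableSpace E] {m : Measure E} [IsProbabilityMeasure m] {p φ : E → ℝ}

/-- The maximal coupling of `p m` and `m`. -/
theorem exists_coupling (hp : Measurable p) (hp0 : ∀ x, 0 ≤ p x) (hpi : Integrable p m)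
    (hp1 : ∫ x, p x ∂m = 1) (hφ : Measurable φ) (hφ0 : ∀ x, 0 ≤ φ x)
    (hi : Integrable (fun x => |p x - 1| * φ x) m) :
    ∃ P ∈ couplings (m.withDensity fun x => ENNReal.ofReal (p x)) m, ∀ f : E × E → ℝ≥0∞,
      (∀ x, f (x, x) = 0) → (∀ z, f z ≤ ENNReal.ofReal (φ z.1 + φ z.2)) →
      ∫⁻ z, f z ∂P ≤ ENNReal.ofReal (∫ x, |p x - 1| * φ x ∂m) := by
  have hm₁ : Measurable fun x => ENNReal.ofReal (p x - 1) := (hp.sub_const 1).ennreal_ofReal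
  have hm₂ : Measurable fun x => ENNReal.ofReal (1 - p x) := (hp.const_sub 1).ennreal_ofReal
  have hm₀ : Measurable fun x => ENNReal.ofReal (min (p x) 1) :=
    (hp.min measurable_const).ennreal_ofReal
  have hφm : Measurable fun x => ENNReal.ofReal (φ x) := hφ.ennreal_ofReal
  have hlp : ∫⁻ x, ENNReal.ofReal (p x) ∂m = 1 := by
    rw [← ofReal_integral_eq_lintegral_ofReal hpi (Filter.Eventually.of_forall hp0), hp1,
      ENNReal.ofReal_one]
  have hs₁ : ∀ x, ENNReal.ofReal (min (p x) 1) + ENNReal.ofReal (p x - 1)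
      = ENNReal.ofReal (p x) := fun x => by
    rcases le_total (p x) 1 with h | h
    · rw [min_eq_left h, ENNReal.ofReal_of_nonpos (sub_nonpos.2 h), add_zero]
    · rw [min_eq_right h, ← ENNReal.ofReal_add zero_le_one (sub_nonneg.2 h)]
      congr 1; ring
  have hs₂ : ∀ x, ENNReal.ofReal (min (p x) 1) + ENNReal.ofReal (1 - p x) = 1 := fun x => by
    rcases le_total (p x) 1 with h | h
    · rw [min_eq_left h, ← ENNReal.ofReal_add (hp0 x) (sub_nonneg.2 h), ← ENNReal.ofReal_one]
      congr 1; ring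
    · rw [min_eq_right h, ENNReal.ofReal_of_nonpos (sub_nonpos.2 h), add_zero, ENNReal.ofReal_one]
  set ν₀ := m.withDensity fun x => ENNReal.ofReal (min (p x) 1) with hν₀
  set ν₁ := m.withDensity fun x => ENNReal.ofReal (p x - 1) with hν₁
  set ν₂ := m.withDensity fun x => ENNReal.ofReal (1 - p x) with hν₂
  have hsum₁ : ν₀ + ν₁ = m.withDensity fun x => ENNReal.ofReal (p x) := by
    rw [hν₀, hν₁, ← withDensity_add_left hm₀]
    congr 1
    ext x
    exact hs₁ x
  have hsum₂ : ν₀ + ν₂ = m := by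
    rw [hν₀, hν₂, ← withDensity_add_left hm₀]
    conv_rhs => rw [← withDensity_one (μ := m)]
    congr 1
    ext x
    exact hs₂ x
  have hu₁ : ν₀ univ + ν₁ univ = 1 := by
    rw [← Measure.add_apply, hsum₁, withDensity_apply _ MeasurableSet.univ,
      Measure.restrict_univ, hlp]
  have hu₂ : ν₀ univ + ν₂ univ = 1 := by
    rw [← Measure.add_apply, hsum₂, measure_univ]
  have hfin₀ : ν₀ univ ≠ ∞ := fun h => by simp [h] at hu₁
  have hZ : ν₂ univ = ν₁ univ := (ENNReal.add_right_inj hfin₀).1 (hu₂.trans hu₁.symm)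
  have hZfin : ν₁ univ ≠ ∞ := fun h => by simp [h] at hu₁
  have : IsFiniteMeasure ν₁ := ⟨hZfin.lt_top⟩
  have : IsFiniteMeasure ν₂ := ⟨by rw [hZ]; exact hZfin.lt_top⟩
  -- If the two measures agree, the mass `ν₁ univ` is zero and its inverse is `∞`, but the measure
  -- being scaled is then zero.
  have hscale : ∀ ν : Measure E, ν univ = ν₁ univ → (ν₁ univ)⁻¹ • (ν₁ univ • ν) = ν := fun ν h => by
    rcases eq_or_ne (ν₁ univ) 0 with h0 | h0
    · have : ν = 0 := Measure.measure_univ_eq_zero.1 (h.trans h0)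
      simp [this]
    · rw [smul_smul, ENNReal.inv_mul_cancel h0 hZfin, one_smul]
  have hd : Measurable fun x : E => (x, x) := measurable_id.prodMk measurable_id
  set N := (ν₁ univ)⁻¹ • (ν₁.prod ν₂) with hN
  have hN₁ : N.map Prod.fst = ν₁ := by
    rw [hN, Measure.map_smul, Measure.map_fst_prod, hZ]
    exact hscale ν₁ rfl
  have hN₂ : N.map Prod.snd = ν₂ := by
    rw [hN, Measure.map_smul, Measure.map_snd_prod]
    exact hscale ν₂ hZ
  -- The common part `min(p, 1) m` sits on the diagonal, where the cost vanishes; the two excess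
  -- parts are coupled independently.
  refine ⟨ν₀.map (fun x => (x, x)) + N, ⟨?_, ?_⟩, fun f hf0 hf => ?_⟩
  · rw [Measure.map_add _ _ measurable_fst, Measure.map_map measurable_fst hd, hN₁, ← hsum₁]
    congr 1
    exact Measure.map_id
  · rw [Measure.map_add _ _ measurable_snd, Measure.map_map measurable_snd hd, hN₂]
    conv_rhs => rw [← hsum₂]
    congr 1
    exact Measure.map_id
  · rw [lintegral_add_measure]
    have h1 : ∫⁻ z, f z ∂ν₀.map (fun x => (x, x)) = 0 := by
      refine le_antisymm ((lintegral_map_le f _).trans ?_) (zero_le)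
      simp [hf0]
    rw [h1, zero_add]
    calc ∫⁻ z, f z ∂N ≤ ∫⁻ z, (ENNReal.ofReal (φ z.1) + ENNReal.ofReal (φ z.2)) ∂N :=
          lintegral_mono fun z => (hf z).trans ENNReal.ofReal_add_le
      _ = ∫⁻ x, ENNReal.ofReal (φ x) ∂ν₁ + ∫⁻ x, ENNReal.ofReal (φ x) ∂ν₂ := by
          have hφm₁ : Measurable fun z : E × E => ENNReal.ofReal (φ z.1) := hφm.comp measurable_fst
          rw [lintegral_add_left hφm₁,
            ← lintegral_map (f := fun x => ENNReal.ofReal (φ x)) hφm measurable_fst,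
            ← lintegral_map (f := fun x => ENNReal.ofReal (φ x)) hφm measurable_snd, hN₁, hN₂]
      _ = ∫⁻ x, ENNReal.ofReal (|p x - 1| * φ x) ∂m := by
          rw [lintegral_withDensity_eq_lintegral_mul _ hm₁ hφm,
            lintegral_withDensity_eq_lintegral_mul _ hm₂ hφm,
            ← lintegral_add_left (hm₁.mul hφm)]
          refine lintegral_congr fun x => ?_
          simp only [Pi.mul_apply]
          rw [← add_mul, ENNReal.ofReal_mul (abs_nonneg _)]
          congr 1
          rcases le_total (p x) 1 with h | h
          · rw [ENNReal.ofReal_of_nonpos (sub_nonpos.2 h), zero_add, abs_sub_comm,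
              abs_of_nonneg (sub_nonneg.2 h)]
          · rw [ENNReal.ofReal_of_nonpos (sub_nonpos.2 h), add_zero,
              abs_of_nonneg (sub_nonneg.2 h)]
      _ ≤ _ := by
          rw [ofReal_integral_eq_lintegral_ofReal hi (Filter.Eventually.of_forall fun x =>
            mul_nonneg (abs_nonneg _) (hφ0 x))]

theorem weightedDist_le [MeasurableEq E] (hp : Measurable p) (hp0 : ∀ x, 0 ≤ p x)
    (hpi : Integrable p m) (hp1 : ∫ x, p x ∂m = 1) (hφ : Measurable φ) (hφ0 : ∀ x, 0 ≤ φ x)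
    (hi : Integrable (fun x => |p x - 1| * φ x) m) :
    weightedDist φ (m.withDensity fun x => ENNReal.ofReal (p x)) m
      ≤ ENNReal.ofReal (∫ x, |p x - 1| * φ x ∂m) := by
  obtain ⟨P, hP, h⟩ := exists_coupling hp hp0 hpi hp1 hφ hφ0 hi
  refine (iInf₂_le P hP).trans ?_
  have hs : MeasurableSet {z : E × E | z.1 ≠ z.2} :=
    (measurableSet_eq_fun measurable_fst measurable_snd).compl
  rw [← lintegral_indicator hs]
  refine h _ (fun x => by simp) fun z => indicator_le_self' (fun _ _ => zero_le) z

theorem wasserstein_le (hp : Measurable p) (hp0 : ∀ x, 0 ≤ p x)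
    (hpi : Integrable p m) (hp1 : ∫ x, p x ∂m = 1) (hφ : Measurable φ) (hφ0 : ∀ x, 0 ≤ φ x)
    (hi : Integrable (fun x => |p x - 1| * φ x) m) {dist : E → E → ℝ} (hd : IsSemiMetric dist)
    (hdφ : ∀ x y, dist x y ≤ φ x + φ y) :
    wasserstein dist (m.withDensity fun x => ENNReal.ofReal (p x)) m
      ≤ ENNReal.ofReal (∫ x, |p x - 1| * φ x ∂m) := by
  obtain ⟨P, hP, h⟩ := exists_coupling hp hp0 hpi hp1 hφ hφ0 hi
  refine (iInf₂_le P hP).trans ?_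
  exact h _ (fun x => by simp [hd.self]) fun z => ENNReal.ofReal_le_ofReal (hdφ _ _)

theorem tvDist_le (hp0 : ∀ x, 0 ≤ p x) (hpi : Integrable p m) :
    tvDist (m.withDensity fun x => ENNReal.ofReal (p x)) m
      ≤ ENNReal.ofReal (∫ x, |p x - 1| ∂m) := by
  refine iSup₂_le fun A hA => ENNReal.ofReal_le_ofReal ?_
  have h1 : (m.withDensity fun x => ENNReal.ofReal (p x)).real A = ∫ x in A, p x ∂m := by
    rw [measureReal_def, withDensity_apply _ hA,
      ← ofReal_integral_eq_lintegral_ofReal hpi.restrict (Filter.Eventually.of_forall hp0),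
      ENNReal.toReal_ofReal (integral_nonneg hp0)]
  have h2 : m.real A = ∫ x in A, (1 : ℝ) ∂m := by simp
  have hi : Integrable (fun x => p x - 1) m := hpi.sub (integrable_const 1)
  rw [h1, h2, ← integral_sub hpi.restrict (integrable_const _)]
  refine abs_integral_le_integral_abs.trans ?_
  exact setIntegral_le_integral hi.abs (Filter.Eventually.of_forall fun x => abs_nonneg _)

theorem weightedSupNorm_llr_le (hp : Measurable p) (hp0 : ∀ x, 0 < p x) (hφ0 : ∀ x, 0 < φ x)
    {c : ℝ} (h : ∀ x, |Real.log (p x)| ≤ c * φ x) :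
    weightedSupNorm m φ (llr (m.withDensity fun x => ENNReal.ofReal (p x)) m)
      ≤ ENNReal.ofReal c := by
  rw [weightedSupNorm, eLpNorm_exponent_top]
  refine eLpNormEssSup_le_of_ae_bound ?_
  filter_upwards [Measure.rnDeriv_withDensity m hp.ennreal_ofReal] with x hx
  rw [llr, hx, ENNReal.toReal_ofReal (hp0 x).le, Real.norm_eq_abs, abs_div, abs_of_pos (hφ0 x),
    div_le_iff₀ (hφ0 x)]
  exact h x

omit [IsProbabilityMeasure m] in
theorem absolutelyContinuous_withDensity_ofReal (hp : Measurable p) (hp0 : ∀ x, 0 < p x) :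
    m ≪ m.withDensity fun x => ENNReal.ofReal (p x) :=
  withDensity_absolutelyContinuous' hp.ennreal_ofReal.aemeasurable
    (Filter.Eventually.of_forall fun x => (ENNReal.ofReal_pos.2 (hp0 x)).ne')

end Distances

/-! ### Relative entropy and the Schrödinger bridge -/

section Bridge

open InformationTheory

variable {X Y : Type*} [MeasurableSpace X] [MeasurableSpace Y]
  {mu : Measure X} [IsProbabilityMeasure mu] {eta : Measure Y} [IsProbabilityMeasure eta]
  {W : X → Y → ℝ} {a a₀ : X → ℝ} {b b₀ : Y → ℝ}

theorem map_swap_scaledMeasure (hW : Measurable (Function.uncurry W)) (ha : Measurable a)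
    (hb : Measurable b) :
    (scaledMeasure mu eta W a b).map Prod.swap = scaledMeasure eta mu (flip W) b a := by
  have hd := measurable_density (k := fun x y => Real.exp (-W x y)) hW.neg.exp ha hb
  rw [scaledMeasure, map_swap_withDensity hd, Measure.prod_swap, scaledMeasure]
  congr 1
  ext z
  simp only [Prod.fst_swap, Prod.snd_swap, flip]
  congr 1
  ring

theorem map_snd_scaledMeasure (hW : Measurable (Function.uncurry W)) (ha : Measurable a)
    (hb : Measurable b) (ha0 : ∀ x, 0 < a x) (hb0 : ∀ y, 0 < b y)
    (h : ∀ y, b y * ∫ x, Real.exp (-W x y) * a x ∂mu = 1) :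
    (scaledMeasure mu eta W a b).map Prod.snd = eta := by
  have hd := measurable_density (k := fun x y => Real.exp (-W x y)) hW.neg.exp ha hb
  rw [scaledMeasure, map_snd_withDensity_prod hd]
  conv_rhs => rw [← withDensity_one (μ := eta)]
  congr 1
  ext y
  have hi := integrable_of_mul_integral_eq_one (h y)
  have e : ∀ x, a x * Real.exp (-W x y) * b y = b y * (Real.exp (-W x y) * a x) :=
    fun x => by ring
  simp_rw [e]
  rw [← ofReal_integral_eq_lintegral_ofReal (hi.const_mul _)
    (Filter.Eventually.of_forall fun x =>
      mul_nonneg (hb0 y).le (mul_nonneg (Real.exp_pos _).le (ha0 x).le)), integral_const_mul, h y]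
  simp

theorem scaledMeasure_mem_couplings (hW : Measurable (Function.uncurry W)) (ha : Measurable a)
    (hb : Measurable b) (ha0 : ∀ x, 0 < a x) (hb0 : ∀ y, 0 < b y)
    (hX : ∀ x, a x * ∫ y, Real.exp (-W x y) * b y ∂eta = 1)
    (hY : ∀ y, b y * ∫ x, Real.exp (-W x y) * a x ∂mu = 1) :
    scaledMeasure mu eta W a b ∈ couplings mu eta := by
  refine ⟨?_, map_snd_scaledMeasure hW ha hb ha0 hb0 hY⟩
  have := map_snd_scaledMeasure (W := flip W) (mu := eta) (eta := mu)
    (hW.comp measurable_swap) hb ha hb0 ha0 hX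
  rw [← map_swap_scaledMeasure hW ha hb, Measure.map_map measurable_snd measurable_swap] at this
  exact this

omit [IsProbabilityMeasure eta] in
theorem isProbabilityMeasure_of_mem_couplings {P : Measure (X × Y)} (h : P ∈ couplings mu eta) :
    IsProbabilityMeasure P := by
  have : IsProbabilityMeasure (P.map Prod.fst) := by rw [h.1]; infer_instance
  exact Measure.isProbabilityMeasure_of_map Prod.fst

/-- The logarithm of the density between two scaled measures. -/
noncomputable def logRatio (a a₀ : X → ℝ) (b b₀ : Y → ℝ) (z : X × Y) : ℝ :=
  (Real.log (a z.1) - Real.log (a₀ z.1)) + (Real.log (b z.2) - Real.log (b₀ z.2))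

theorem measurable_logRatio (ha : Measurable a) (hb : Measurable b) (hma : Measurable a₀)
    (hmb : Measurable b₀) : Measurable (logRatio a a₀ b b₀) :=
  ((ha.comp measurable_fst).log.sub (hma.comp measurable_fst).log).add
    ((hb.comp measurable_snd).log.sub (hmb.comp measurable_snd).log)

-- The factor `e^{-W}` cancels in the ratio of two scaled measures, leaving an exponential tilt by a
-- sum of one-variable functions; its normalizing constant is one because the tilted measure is a
-- probability.
omit [IsProbabilityMeasure mu] [IsProbabilityMeasure eta] in
theorem scaledMeasure_eq_tilted (hW : Measurable (Function.uncurry W)) (ha : Measurable a)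
    (hb : Measurable b) (ha0 : ∀ x, 0 < a x) (hb0 : ∀ y, 0 < b y)
    (hma : Measurable a₀) (hmb : Measurable b₀) (ha₀ : ∀ x, 0 < a₀ x) (hb₀ : ∀ y, 0 < b₀ y)
    [IsProbabilityMeasure (scaledMeasure mu eta W a b)] :
    Integrable (fun z => Real.exp (logRatio a a₀ b b₀ z)) (scaledMeasure mu eta W a₀ b₀) ∧
    ∫ z, Real.exp (logRatio a a₀ b b₀ z) ∂(scaledMeasure mu eta W a₀ b₀) = 1 ∧
    scaledMeasure mu eta W a b = (scaledMeasure mu eta W a₀ b₀).tilted (logRatio a a₀ b b₀) := by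
  have hl := measurable_logRatio ha hb hma hmb
  have hle : Measurable fun z => ENNReal.ofReal (Real.exp (logRatio a a₀ b b₀ z)) :=
    hl.exp.ennreal_ofReal
  have hd := measurable_density (k := fun x y => Real.exp (-W x y)) hW.neg.exp hma hmb
  have heq : scaledMeasure mu eta W a b = (scaledMeasure mu eta W a₀ b₀).withDensity
      (fun z => ENNReal.ofReal (Real.exp (logRatio a a₀ b b₀ z))) := by
    rw [scaledMeasure, scaledMeasure, ← withDensity_mul _ hd hle]
    congr 1
    ext z
    simp only [Pi.mul_apply]
    rw [← ENNReal.ofReal_mul (mul_nonneg (mul_nonneg (ha₀ _).le (Real.exp_pos _).le) (hb₀ _).le),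
      logRatio, Real.exp_add, Real.exp_sub, Real.exp_sub, Real.exp_log (ha0 _),
      Real.exp_log (ha₀ _), Real.exp_log (hb0 _), Real.exp_log (hb₀ _)]
    congr 1
    have := (ha₀ z.1).ne'
    have := (hb₀ z.2).ne'
    field_simp
  have hone : ∫⁻ z, ENNReal.ofReal (Real.exp (logRatio a a₀ b b₀ z))
      ∂(scaledMeasure mu eta W a₀ b₀) = 1 := by
    have : scaledMeasure mu eta W a b univ = 1 := measure_univ
    rwa [heq, withDensity_apply _ MeasurableSet.univ, Measure.restrict_univ] at this
  have hi : Integrable (fun z => Real.exp (logRatio a a₀ b b₀ z))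
      (scaledMeasure mu eta W a₀ b₀) := by
    refine ⟨hl.exp.aestronglyMeasurable, ?_⟩
    rw [hasFiniteIntegral_iff_ofReal (Filter.Eventually.of_forall fun z => (Real.exp_pos _).le),
      hone]
    exact ENNReal.one_lt_top
  have h1 : ∫ z, Real.exp (logRatio a a₀ b b₀ z) ∂(scaledMeasure mu eta W a₀ b₀) = 1 := by
    have := ofReal_integral_eq_lintegral_ofReal hi
      (Filter.Eventually.of_forall fun z => (Real.exp_pos _).le)
    rw [hone] at this
    exact ENNReal.ofReal_eq_one.1 this
  refine ⟨hi, h1, ?_⟩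
  rw [Measure.tilted, h1, heq]
  simp

-- A sum of one-variable functions is integrated through the marginals alone, so the value is common
-- to all couplings. Optimality of the bridge rests on this.
omit [IsProbabilityMeasure mu] [IsProbabilityMeasure eta] in
theorem integrable_logRatio {P : Measure (X × Y)} (hP : P ∈ couplings mu eta)
    (hA : Integrable (fun x => Real.log (a x) - Real.log (a₀ x)) mu)
    (hB : Integrable (fun y => Real.log (b y) - Real.log (b₀ y)) eta) :
    Integrable (logRatio a a₀ b b₀) P ∧ ∫ z, logRatio a a₀ b b₀ z ∂P
      = ∫ x, (Real.log (a x) - Real.log (a₀ x)) ∂mu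
        + ∫ y, (Real.log (b y) - Real.log (b₀ y)) ∂eta := by
  rw [← hP.1] at hA
  rw [← hP.2] at hB
  have h1 : Integrable (fun z : X × Y => Real.log (a z.1) - Real.log (a₀ z.1)) P :=
    hA.comp_measurable measurable_fst
  have h2 : Integrable (fun z : X × Y => Real.log (b z.2) - Real.log (b₀ z.2)) P :=
    hB.comp_measurable measurable_snd
  refine ⟨h1.add h2, ?_⟩
  simp only [logRatio]
  rw [integral_add h1 h2]
  congr 1
  · conv_rhs => rw [← hP.1]
    exact (integral_map measurable_fst.aemeasurable hA.aestronglyMeasurable).symm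
  · conv_rhs => rw [← hP.2]
    exact (integral_map measurable_snd.aemeasurable hB.aestronglyMeasurable).symm

section Entropy

variable {m P : Measure (X × Y)} [IsProbabilityMeasure m] [IsProbabilityMeasure P]
  {l : X × Y → ℝ} {s : ℝ}

theorem klDiv_tilted (hl : Integrable (fun z => Real.exp (l z)) m)
    (hl1 : ∫ z, Real.exp (l z) ∂m = 1) (hP : P = m.tilted l) (hlm : Measurable l) (hli : Integrable l P) :
    P ≪ m ∧ 0 ≤ ∫ z, l z ∂P ∧ klDiv P m = ENNReal.ofReal (∫ z, l z ∂P) := by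
  have hac : P ≪ m := by rw [hP]; exact tilted_absolutelyContinuous m l
  have hllr : llr P m =ᵐ[P] l := by
    refine hac.ae_le ?_
    filter_upwards [llr_tilted_left (μ := m) (ν := m) Measure.AbsolutelyContinuous.rfl hl
      hlm.aemeasurable, llr_self m] with z h1 h2
    rw [hP, h1, h2, hl1]
    simp
  have hi : Integrable (llr P m) P := hli.congr hllr.symm
  have h0 := integral_llr_add_sub_measure_univ_nonneg hac hi
  have e := klDiv_of_ac_of_integrable hac hi
  rw [integral_congr_ae hllr] at h0 e
  simp only [probReal_univ, add_sub_cancel_right] at h0 e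
  exact ⟨hac, h0, e⟩

/-- The Pythagorean identity for the relative entropy. -/
theorem klDiv_eq_add_of_tilted {P' : Measure (X × Y)} [IsProbabilityMeasure P']
    (hl : Integrable (fun z => Real.exp (l z)) m)
    (hl1 : ∫ z, Real.exp (l z) ∂m = 1) (hP : P = m.tilted l) (hs : 0 ≤ s)
    (hli : Integrable l P') (hls : ∫ z, l z ∂P' = s) :
    klDiv P' m = ∞ ∨ klDiv P' m = klDiv P' P + ENNReal.ofReal s := by
  by_cases h : klDiv P' m = ∞
  · exact Or.inl h
  right
  obtain ⟨hac, hi⟩ := klDiv_ne_top_iff.1 h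
  have hac' : P' ≪ P := by
    rw [hP]
    exact hac.trans (absolutelyContinuous_tilted hl)
  have hllr : llr P' P =ᵐ[P'] fun z => llr P' m z - l z := by
    filter_upwards [llr_tilted_right hac hl] with z hz
    rw [hP, hz, hl1]
    simp only [Real.log_one]
    ring
  have hi' : Integrable (llr P' P) P' := (hi.sub hli).congr hllr.symm
  have h0 := integral_llr_add_sub_measure_univ_nonneg hac' hi'
  have e := klDiv_of_ac_of_integrable hac' hi'
  rw [klDiv_of_ac_of_integrable hac hi, e]
  rw [integral_congr_ae hllr, integral_sub hi hli, hls] at h0 ⊢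
  simp only [probReal_univ, add_sub_cancel_right] at h0 ⊢
  rw [← ENNReal.ofReal_add h0 hs, sub_add_cancel]

end Entropy

omit [IsProbabilityMeasure eta] in
/-- A coupling obtained by scaling a reference measure is its unique Schrödinger bridge. -/
theorem isSchrodingerBridge_scaledMeasure {R : Measure (X × Y)} [IsProbabilityMeasure R]
    (hR : R = scaledMeasure mu eta W a₀ b₀)
    (hW : Measurable (Function.uncurry W)) (ha : Measurable a)
    (hb : Measurable b) (ha0 : ∀ x, 0 < a x) (hb0 : ∀ y, 0 < b y)
    (hma : Measurable a₀) (hmb : Measurable b₀) (ha₀ : ∀ x, 0 < a₀ x) (hb₀ : ∀ y, 0 < b₀ y)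
    (hP : scaledMeasure mu eta W a b ∈ couplings mu eta)
    (hA : Integrable (fun x => Real.log (a x) - Real.log (a₀ x)) mu)
    (hB : Integrable (fun y => Real.log (b y) - Real.log (b₀ y)) eta) :
    IsSchrodingerBridge mu eta R (scaledMeasure mu eta W a b) ∧
    (∀ P', IsSchrodingerBridge mu eta R P' → P' = scaledMeasure mu eta W a b) ∧
    klDiv (scaledMeasure mu eta W a b) R
      = ENNReal.ofReal (∫ x, (Real.log (a x) - Real.log (a₀ x)) ∂mu
        + ∫ y, (Real.log (b y) - Real.log (b₀ y)) ∂eta) := by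
  have hprob := isProbabilityMeasure_of_mem_couplings hP
  obtain ⟨h1, h2, h3⟩ := scaledMeasure_eq_tilted (mu := mu) (eta := eta) hW ha hb ha0 hb0 hma hmb
    ha₀ hb₀
  rw [← hR] at h1 h2 h3
  obtain ⟨hli, hls⟩ := integrable_logRatio hP hA hB
  obtain ⟨-, hs0, hkl⟩ := klDiv_tilted h1 h2 h3 (measurable_logRatio ha hb hma hmb) hli
  rw [hls] at hs0 hkl
  -- Both optimality and uniqueness follow: the entropy of a coupling exceeds that of the candidate
  -- by its own entropy relative to the candidate.
  have hpyth : ∀ P' ∈ couplings mu eta, klDiv P' R = ∞ ∨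
      klDiv P' R = klDiv P' (scaledMeasure mu eta W a b)
        + klDiv (scaledMeasure mu eta W a b) R := fun P' hP' => by
    have := isProbabilityMeasure_of_mem_couplings hP'
    obtain ⟨hli', hls'⟩ := integrable_logRatio hP' hA hB
    rw [hkl]
    exact klDiv_eq_add_of_tilted h1 h2 h3 hs0 hli' hls'
  have hbr : IsSchrodingerBridge mu eta R (scaledMeasure mu eta W a b) := by
    refine ⟨hP, fun P' hP' => ?_⟩
    rcases hpyth P' hP' with h | h
    · rw [h]; exact le_top
    · rw [h]; exact le_add_self
  refine ⟨hbr, fun P' hP' => ?_, hkl⟩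
  have hfin : klDiv (scaledMeasure mu eta W a b) R ≠ ∞ := by
    rw [hkl]; exact ENNReal.ofReal_ne_top
  have hle := hP'.2 _ hP
  have := isProbabilityMeasure_of_mem_couplings hP'.1
  rcases hpyth P' hP'.1 with h | h
  · rw [h] at hle
    exact absurd (top_le_iff.1 hle) hfin
  · rw [h] at hle
    have h0 : klDiv P' (scaledMeasure mu eta W a b) = 0 := by
      by_contra hne
      exact absurd hle (not_le.2 (by
        rw [add_comm]; exact ENNReal.lt_add_right hfin hne))
    exact klDiv_eq_zero_iff.1 h0

end Bridge

/-! ### Assembly of the rates -/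

section Main

theorem marginal_bounds {E : Type*} [MeasurableSpace E] [MeasurableEq E] {m π : Measure E}
    [IsProbabilityMeasure m] {p φ : E → ℝ}
    (hπ : π = m.withDensity fun x => ENNReal.ofReal (p x)) (hp : Measurable p)
    (hp0 : ∀ x, 0 < p x) (hpi : Integrable p m) (hp1 : ∫ x, p x ∂m = 1) (hφ : Measurable φ)
    {c₀ : ℝ} (hc₀ : 0 < c₀) (hφ0 : ∀ x, c₀ ≤ φ x)
    (hi : Integrable (fun x => |p x - 1| * φ x) m) {s t : ℝ}
    (hs : ∫ x, |p x - 1| * φ x ∂m ≤ s) (hlog : ∀ x, |Real.log (p x)| ≤ s * φ x)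
    (hst : s ≤ t) (hst' : c₀⁻¹ * s ≤ t) :
    weightedDist φ π m ≤ ENNReal.ofReal t ∧ π ≪ m ∧ m ≪ π ∧
      weightedSupNorm m φ (llr π m) ≤ ENNReal.ofReal t ∧ tvDist π m ≤ ENNReal.ofReal t ∧
      ∀ dist : E → E → ℝ, IsSemiMetric dist → Measurable (Function.uncurry dist) →
        (∀ x y, dist x y ≤ φ x + φ y) → wasserstein dist π m ≤ ENNReal.ofReal t := by
  subst hπ
  have hφpos : ∀ x, 0 < φ x := fun x => hc₀.trans_le (hφ0 x)
  have hst1 := ENNReal.ofReal_le_ofReal (hs.trans hst)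
  refine ⟨(weightedDist_le hp (fun x => (hp0 x).le) hpi hp1 hφ (fun x => (hφpos x).le) hi).trans
    hst1, withDensity_absolutelyContinuous _ _, absolutelyContinuous_withDensity_ofReal hp hp0,
    (weightedSupNorm_llr_le hp hp0 hφpos hlog).trans (ENNReal.ofReal_le_ofReal hst),
    (tvDist_le (fun x => (hp0 x).le) hpi).trans (ENNReal.ofReal_le_ofReal ?_),
    fun dist hd _ hdφ => (wasserstein_le hp (fun x => (hp0 x).le) hpi hp1 hφ
      (fun x => (hφpos x).le) hi hd hdφ).trans hst1⟩
  refine le_trans ?_ ((mul_le_mul_of_nonneg_left hs (inv_pos.2 hc₀).le).trans hst')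
  rw [← integral_const_mul]
  refine integral_mono (hpi.sub (integrable_const 1)).abs (hi.const_mul _) fun x => ?_
  have h1 : 1 ≤ c₀⁻¹ * φ x := by rw [inv_mul_eq_div, one_le_div hc₀]; exact hφ0 x
  calc |p x - 1| = |p x - 1| * 1 := (mul_one _).symm
    _ ≤ |p x - 1| * (c₀⁻¹ * φ x) := mul_le_mul_of_nonneg_left h1 (abs_nonneg _)
    _ = _ := by ring

variable {X Y : Type*} [MeasurableSpace X] [MeasurableSpace Y]
  {mu : Measure X} [IsProbabilityMeasure mu] {eta : Measure Y} [IsProbabilityMeasure eta]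
  {W : X → Y → ℝ} {φ : X → ℝ} {ψ : Y → ℝ} {V : Y → ℝ} {cX CX cY CY : ℝ}

theorem Admissible.regular (H : Admissible mu eta W φ ψ) (hV : Normalized eta W V)
    (hcX : 0 < cX) (hcY : 0 < cY)
    (hband : ∀ n, Band (expCost W eta) cX CX (potX mu eta W V n) ∧
      Band (expCost (flip W) mu) cY CY (potY mu eta W V (n + 1))) : Regular mu eta W V := by
  have posY : ∀ n y, 0 < potY mu eta W V n y
    | 0, y => Real.exp_pos _
    | n + 1, y => (hband n).2.pos hcY y
  have intY : ∀ n x, Integrable (fun y => Real.exp (-W x y) * potY mu eta W V n y) eta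
    | 0, x => hV.integrable_kernel x
    | n + 1, x => H.integrable_kernel_mul
        ((hband n).2.integrable hcY H.swap.integrable_expCost) x
  have intX := fun n => H.swap.integrable_kernel_mul
    ((hband n).1.integrable hcX H.integrable_expCost)
  exact {
    meas_cost := H.measurable_cost
    measX := fun n => (hband n).1.meas
    measY := fun n => match n with
      | 0 => hV.meas.exp
      | n + 1 => (hband n).2.meas
    posX := fun n => (hband n).1.pos hcX
    posY := posY
    mulX := fun n x => scaling_mul (posY n) (intY n x)
    mulY := fun n y => scaling_mul ((hband n).1.pos hcX) (intX n y) }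

theorem integral_log_sub_le {c L s : ℝ} {G a a₀ : X → ℝ} (hc : 0 < c) (hG : Integrable G mu)
    {C : ℝ} (ha : Band G c C a) (ha₀ : Integrable (fun x => Real.log (a₀ x)) mu)
    (hφ : Integrable φ mu)
    (h : ∀ x, |Real.log (a x) - Real.log (a₀ x)| ≤ L * φ x * s) :
    ∫ x, (Real.log (a x) - Real.log (a₀ x)) ∂mu ≤ L * s * ∫ x, φ x ∂mu := by
  rw [← integral_const_mul]
  refine integral_mono ((ha.integrable_log hc hG).sub ha₀) (hφ.const_mul _) fun x => ?_
  calc Real.log (a x) - Real.log (a₀ x) ≤ L * φ x * s := (le_abs_self _).trans (h x)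
    _ = _ := by ring

variable [StandardBorelSpace X] [Nonempty X] [StandardBorelSpace Y] [Nonempty Y]
  [MeasurableEq X] [MeasurableEq Y] {Q : Kernel X Y} [IsMarkovKernel Q]

/-- Geometric convergence of the Sinkhorn marginals and bridges. -/
theorem Admissible.sinkhorn_convergence (H : Admissible mu eta W φ ψ) (hV : Normalized eta W V)
    (hQ : mu ⊗ₘ Q = scaledMeasure mu eta W (fun _ => 1) (fun y => Real.exp (V y))) :
    ∃ ρ ∈ Ioo (0 : ℝ) 1, ∃ n₀ : ℕ, 1 ≤ n₀ ∧ ∃ c : ℝ, 0 < c ∧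
      (∀ n ≥ n₀,
        weightedDist ψ (evenMarginal mu eta Q n) eta ≤ ENNReal.ofReal (c * ρ ^ n) ∧
        evenMarginal mu eta Q n ≪ eta ∧ eta ≪ evenMarginal mu eta Q n ∧
        weightedSupNorm eta ψ (llr (evenMarginal mu eta Q n) eta)
            ≤ ENNReal.ofReal (c * ρ ^ n) ∧
        tvDist (evenMarginal mu eta Q n) eta ≤ ENNReal.ofReal (c * ρ ^ n) ∧
        ∀ dist : Y → Y → ℝ, IsSemiMetric dist → Measurable (Function.uncurry dist) →
          (∀ y₁ y₂, dist y₁ y₂ ≤ ψ y₁ + ψ y₂) →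
          wasserstein dist (evenMarginal mu eta Q n) eta ≤ ENNReal.ofReal (c * ρ ^ n)) ∧
      (∀ n ≥ n₀,
        weightedDist φ (oddMarginal mu eta Q n) mu ≤ ENNReal.ofReal (c * ρ ^ n) ∧
        oddMarginal mu eta Q n ≪ mu ∧ mu ≪ oddMarginal mu eta Q n ∧
        weightedSupNorm mu φ (llr (oddMarginal mu eta Q n) mu)
            ≤ ENNReal.ofReal (c * ρ ^ n) ∧
        tvDist (oddMarginal mu eta Q n) mu ≤ ENNReal.ofReal (c * ρ ^ n) ∧
        ∀ dist : X → X → ℝ, IsSemiMetric dist → Measurable (Function.uncurry dist) →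
          (∀ x₁ x₂, dist x₁ x₂ ≤ φ x₁ + φ x₂) →
          wasserstein dist (oddMarginal mu eta Q n) mu ≤ ENNReal.ofReal (c * ρ ^ n)) ∧
      ∃ P : Measure (X × Y),
        IsSchrodingerBridge mu eta (mu ⊗ₘ Q) P ∧
        (∀ P', IsSchrodingerBridge mu eta (mu ⊗ₘ Q) P' → P' = P) ∧
        ∀ n : ℕ, InformationTheory.klDiv P (evenBridge mu eta Q n)
            ≤ ENNReal.ofReal (c * ρ ^ n) := by
  obtain ⟨cX, hcX, CX, hCX, cY, hcY, CY, hCY, hband⟩ := H.exists_bands hV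
  obtain ⟨ρ, hρ0, hρ1, C, hC, hgeo⟩ := H.geometric hcX hcY hCX hCY hband
  obtain ⟨a, b, ha, hb, hab, hba, hla, hlb⟩ := H.exists_fixedPoint hcX hcY hband hρ1
    (fun n => (hgeo n).2.2.1) (fun n => (hgeo n).2.2.2)
  have R := H.regular hV hcX hcY hband
  have hone : potX mu eta W V 0 = fun _ => 1 := by
    ext x
    simp [potX, potY, scaling, hV.integral_kernel x]
  have hbridge := R.evenBridge_eq hQ hone
  have hGX := H.integrable_expCost
  have hGY := H.swap.integrable_expCost
  have hprob : ∀ n, IsProbabilityMeasure (evenBridge mu eta Q n) := fun n =>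
    inferInstanceAs (IsProbabilityMeasure (mu ⊗ₘ evenKernel mu eta Q n))
  have ha0 := ha.pos hcX
  have hb0 := hb.pos hcY
  have hP : scaledMeasure mu eta W a b ∈ couplings mu eta := by
    refine scaledMeasure_mem_couplings H.measurable_cost ha.meas hb.meas ha0 hb0 (fun x => ?_)
      fun y => ?_
    · rw [hab]
      exact scaling_mul hb0 (H.integrable_kernel_mul (hb.integrable hcY hGY) x)
    · rw [hba]
      exact scaling_mul ha0 (H.swap.integrable_kernel_mul (ha.integrable hcX hGX) y)
  have hlogX : ∀ n, Integrable (fun x => Real.log (potX mu eta W V n x)) mu := fun n =>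
    (hband n).1.integrable_log hcX hGX
  have hlogY : ∀ n, Integrable (fun y => Real.log (potY mu eta W V n y)) eta := fun n =>
    match n with
    | 0 => by simpa [potY] using hV.integrable
    | n + 1 => (hband n).2.integrable_log hcY hGY
  have hent := fun n => isSchrodingerBridge_scaledMeasure (hbridge n) H.measurable_cost ha.meas
    hb.meas ha0 hb0 (R.measX n) (R.measY n) (R.posX n) (R.posY n) hP
    ((ha.integrable_log hcX hGX).sub (hlogX n)) ((hb.integrable_log hcY hGY).sub (hlogY n))
  obtain ⟨dX, hdX, hφd⟩ := H.lower_left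
  obtain ⟨dY, hdY, hψd⟩ := H.lower_right
  set IX := ∫ x, φ x ∂mu with hIX
  set IY := ∫ y, ψ y ∂eta with hIY
  have hIX0 : 0 ≤ IX := integral_nonneg fun x => (H.left_pos x).le
  have hIY0 : 0 ≤ IY := integral_nonneg fun y => (H.right_pos y).le
  -- The entropy at `n = 0`, which the geometric estimates, starting at index one, do not cover.
  set e₀ := |∫ x, (Real.log (a x) - Real.log (potX mu eta W V 0 x)) ∂mu
        + ∫ y, (Real.log (b y) - Real.log (potY mu eta W V 0 y)) ∂eta| with he₀
  have h1ρ : 0 < 1 - ρ := sub_pos.2 hρ1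
  -- Collects every multiplier met below: `1` for the weighted estimates, inverse lower bounds of
  -- the weights for total variation, and the integrated weights over `1 - ρ` for the entropy.
  set F := 1 + dX⁻¹ + dY⁻¹ + (IX + IY) / (1 - ρ) with hF
  have hF0 : 0 < F := by positivity
  -- Division by `ρ` compensates for the geometric bounds carrying `ρ ^ k` at index `k + 1`.
  set c := C * F / ρ + e₀ + 1 with hc
  have he₀0 : 0 ≤ e₀ := abs_nonneg _
  have hc0 : 0 < c := by positivity
  have hkey : ∀ f, f ≤ F → ∀ k, f * (C * ρ ^ k) ≤ c * ρ ^ (k + 1) := fun f hf k => by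
    have hpk : 0 < ρ ^ k := pow_pos hρ0 k
    calc f * (C * ρ ^ k) ≤ F * (C * ρ ^ k) := mul_le_mul_of_nonneg_right hf (by positivity)
      _ = C * F / ρ * ρ ^ (k + 1) := by rw [pow_succ]; field_simp
      _ ≤ c * ρ ^ (k + 1) := mul_le_mul_of_nonneg_right (by rw [hc]; linarith) (by positivity)
  have hdX' : 0 < dX⁻¹ := inv_pos.2 hdX
  have hdY' : 0 < dY⁻¹ := inv_pos.2 hdY
  have hI' : 0 ≤ (IX + IY) / (1 - ρ) := by positivity
  have hk1 : ∀ k, C * ρ ^ k ≤ c * ρ ^ (k + 1) := fun k => by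
    simpa using hkey 1 (by rw [hF]; linarith) k
  refine ⟨ρ, ⟨hρ0, hρ1⟩, 1, le_rfl, c, hc0, ?_, ?_, scaledMeasure mu eta W a b, ?_, ?_, ?_⟩
  · intro n hn
    obtain ⟨k, rfl⟩ : ∃ k, n = k + 1 := ⟨n - 1, by omega⟩
    obtain ⟨-, g2, -, g4⟩ := hgeo k
    have hB₀ := (hband k).2
    have hB₁ := (hband (k + 1)).2
    have hint : ∀ x, Integrable (fun y => Real.exp (-W x y) * potY mu eta W V (k + 1) y) eta :=
      H.integrable_kernel_mul (hB₀.integrable hcY hGY)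
    refine marginal_bounds (R.evenMarginal_eq (hbridge (k + 1))) (hB₀.meas.div hB₁.meas)
      (fun y => div_pos (hB₀.pos hcY y) (hB₁.pos hcY y))
      (integrable_div_scaling H.measurable_cost hB₀.meas (hB₀.pos hcY) hint)
      (integral_div_scaling H.measurable_cost hB₀.meas (hB₀.pos hcY) hint) H.measurable_right
      hdY hψd (H.swap.integrable_abs_div_sub_one hcY hCY hB₀ hB₁) g2 (fun y => ?_) (hk1 k)
      (hkey _ (by rw [hF]; linarith) k)
    rw [Real.log_div (hB₀.pos hcY y).ne' (hB₁.pos hcY y).ne', abs_sub_comm]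
    exact (g4 y).trans_eq (by ring)
  · intro n hn
    obtain ⟨k, rfl⟩ : ∃ k, n = k + 1 := ⟨n - 1, by omega⟩
    obtain ⟨g1, -, g3, -⟩ := hgeo k
    have hA₀ := (hband (k + 1)).1
    have hA₁ := (hband (k + 2)).1
    have hint : ∀ y, Integrable (fun x => Real.exp (-flip W y x) * potX mu eta W V (k + 1) x) mu :=
      H.swap.integrable_kernel_mul (hA₀.integrable hcX hGX)
    refine marginal_bounds (R.oddMarginal_eq (hbridge (k + 1))) (hA₀.meas.div hA₁.meas)
      (fun x => div_pos (hA₀.pos hcX x) (hA₁.pos hcX x))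
      (integrable_div_scaling H.swap.measurable_cost hA₀.meas (hA₀.pos hcX) hint)
      (integral_div_scaling H.swap.measurable_cost hA₀.meas (hA₀.pos hcX) hint) H.measurable_left
      hdX hφd (H.integrable_abs_div_sub_one hcX hCX hA₀ hA₁) g1 (fun x => ?_) (hk1 k)
      (hkey _ (by rw [hF]; linarith) k)
    rw [Real.log_div (hA₀.pos hcX x).ne' (hA₁.pos hcX x).ne', abs_sub_comm]
    exact (g3 x).trans_eq (by ring)
  · exact (hent 0).1
  · exact (hent 0).2.1
  · intro n
    rw [(hent n).2.2]
    refine ENNReal.ofReal_le_ofReal ?_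
    cases n with
    | zero =>
      refine (le_abs_self _).trans ?_
      rw [pow_zero, mul_one, ← he₀, hc]
      have : 0 ≤ C * F / ρ := by positivity
      linarith
    | succ k =>
      have h1 := integral_log_sub_le (L := C / (1 - ρ)) (s := ρ ^ k) hcX hGX ha (hlogX (k + 1))
        H.integrable_phi (fun x => (hla k x).trans_eq (by ring))
      have h2 := integral_log_sub_le (L := C / (1 - ρ)) (s := ρ ^ k) hcY hGY hb (hlogY (k + 1))
        H.integrable_psi (fun y => (hlb k y).trans_eq (by ring))
      refine (add_le_add h1 h2).trans
        (le_trans (le_of_eq ?_) (hkey ((IX + IY) / (1 - ρ)) (by rw [hF]; linarith) k))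
      rw [← hIX, ← hIY]
      ring

end Main

/-! ### From compact sub-level sets to the abstract conditions -/

section Topological

theorem exists_le_of_compactSublevels {E : Type*} [TopologicalSpace E] {f : E → ℝ}
    (hf : LocallyBdd f) (hfc : CompactSublevels f) : ∃ u, ∀ x, u ≤ f x := by
  obtain ⟨C, hC⟩ := hf _ (hfc 0)
  refine ⟨min (-C) 0, fun x => ?_⟩
  rcases le_total (f x) 0 with h | h
  · exact (min_le_left _ _).trans (neg_le_of_abs_le (hC x h))
  · exact (min_le_right _ _).trans h

theorem LocallyBdd.const_mul {E : Type*} [TopologicalSpace E] {f : E → ℝ} (hf : LocallyBdd f)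
    {s : ℝ} (hs : 0 < s) : LocallyBdd fun x => s * f x := fun K hK => by
  obtain ⟨C, hC⟩ := hf K hK
  refine ⟨s * C, fun x hx => ?_⟩
  rw [abs_mul, abs_of_pos hs]
  exact mul_le_mul_of_nonneg_left (hC x hx) hs.le

/-- Where `f - g ≥ -log ε` the term `ε e^f` dominates; the remaining set is compact and both
functions are bounded there. -/
theorem exists_exp_sub_le {E : Type*} [TopologicalSpace E] {f g : E → ℝ} (hf : LocallyBdd f)
    (hg : LocallyBdd fun x => f x - g x) (hgc : CompactSublevels fun x => f x - g x)
    {ε : ℝ} (hε : 0 < ε) : ∃ C, ∀ x, Real.exp (g x) ≤ ε * Real.exp (f x) + C := by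
  obtain ⟨A, hA⟩ := hf _ (hgc (-Real.log ε))
  obtain ⟨B, hB⟩ := hg _ (hgc (-Real.log ε))
  refine ⟨Real.exp (A + B), fun x => ?_⟩
  rcases le_total (f x - g x) (-Real.log ε) with h | h
  · have h1 := abs_le.1 (hA x h)
    have h2 := abs_le.1 (hB x h)
    have h3 : Real.exp (g x) ≤ Real.exp (A + B) := Real.exp_le_exp.2 (by linarith)
    have h4 := mul_pos hε (Real.exp_pos (f x))
    linarith
  · have h1 : Real.exp (g x) ≤ Real.exp (Real.log ε + f x) := Real.exp_le_exp.2 (by linarith)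
    rw [Real.exp_add, Real.exp_log hε] at h1
    linarith [Real.exp_pos (A + B)]

/-- The square of the weight is `e^{δU}`, and `e^{δU} e^{-U} = e^{-(1-δ)U}`. -/
theorem integrable_sq_exp_gibbs {E : Type*} [MeasurableSpace E] {m : Measure E} {U : E → ℝ}
    (hU : Measurable U) {δ : ℝ} (h : gibbs m (fun x => (1 - δ) * U x) univ < ∞) :
    Integrable (fun x => Real.exp (δ / 2 * U x) ^ 2) (gibbs m U) := by
  have hm : Measurable fun x => Real.exp (δ / 2 * U x) ^ 2 := ((hU.const_mul _).exp).pow_const 2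
  have hmU : Measurable fun x => ENNReal.ofReal (Real.exp (-U x)) := hU.neg.exp.ennreal_ofReal
  refine ⟨hm.aestronglyMeasurable, ?_⟩
  rw [hasFiniteIntegral_iff_ofReal (Filter.Eventually.of_forall fun x => sq_nonneg _), gibbs,
    lintegral_withDensity_eq_lintegral_mul _ hmU hm.ennreal_ofReal]
  rw [gibbs, withDensity_apply _ MeasurableSet.univ, Measure.restrict_univ] at h
  convert h using 1
  refine lintegral_congr fun x => ?_
  simp only [Pi.mul_apply]
  rw [← ENNReal.ofReal_mul (Real.exp_pos _).le, sq, ← Real.exp_add, ← Real.exp_add]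
  congr 2
  ring

theorem admissible_gibbs {X Y : Type*} [TopologicalSpace X] [MeasurableSpace X]
    [TopologicalSpace Y] [MeasurableSpace Y]
    {lam : Measure X} {nu : Measure Y} {U : X → ℝ} {V : Y → ℝ} {W : X → Y → ℝ}
    (hUm : Measurable U) (hVm : Measurable V) (hWm : Measurable (Function.uncurry W))
    (hW : LocallyBdd (Function.uncurry W)) (hWbelow : ∃ w : ℝ, ∀ x y, w ≤ W x y)
    (hU : LocallyBdd U) (hUc : CompactSublevels U)
    (hV : LocallyBdd V) (hVc : CompactSublevels V)
    (hWV : ∀ x, Integrable (fun y => W x y) (gibbs nu V))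
    (hWU : ∀ y, Integrable (fun x => W x y) (gibbs lam U))
    {δ : ℝ} (hδ : 0 < δ)
    (hUδ' : LocallyBdd fun x => δ / 2 * U x - costX W (gibbs nu V) x)
    (hUδc : CompactSublevels fun x => δ / 2 * U x - costX W (gibbs nu V) x)
    (hVδ' : LocallyBdd fun y => δ / 2 * V y - costY W (gibbs lam U) y)
    (hVδc : CompactSublevels fun y => δ / 2 * V y - costY W (gibbs lam U) y)
    (hUδ : gibbs lam (fun x => (1 - δ) * U x) univ < ∞)
    (hVδ : gibbs nu (fun y => (1 - δ) * V y) univ < ∞) :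
    Admissible (gibbs lam U) (gibbs nu V) W (fun x => Real.exp (δ / 2 * U x))
      (fun y => Real.exp (δ / 2 * V y)) := by
  have hsub : ∀ (r t : ℝ), Real.exp (δ / 2 * t) ≤ r → t ≤ 2 / δ * Real.log r := fun r t h => by
    have h1 := (Real.le_log_iff_exp_le ((Real.exp_pos _).trans_le h)).2 h
    calc t = 2 / δ * (δ / 2 * t) := by field_simp
      _ ≤ _ := mul_le_mul_of_nonneg_left h1 (by positivity)
  obtain ⟨u, hu⟩ := exists_le_of_compactSublevels hU hUc
  obtain ⟨v, hv⟩ := exists_le_of_compactSublevels hV hVc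
  exact {
    measurable_cost := hWm
    bddBelow := hWbelow
    integrable_left := hWV
    integrable_right := hWU
    measurable_left := (hUm.const_mul _).exp
    measurable_right := (hVm.const_mul _).exp
    lower_left := ⟨Real.exp (δ / 2 * u), Real.exp_pos _, fun x =>
      Real.exp_le_exp.2 (mul_le_mul_of_nonneg_left (hu x) (half_pos hδ).le)⟩
    lower_right := ⟨Real.exp (δ / 2 * v), Real.exp_pos _, fun y =>
      Real.exp_le_exp.2 (mul_le_mul_of_nonneg_left (hv y) (half_pos hδ).le)⟩
    sq_left := integrable_sq_exp_gibbs hUm hUδ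
    sq_right := integrable_sq_exp_gibbs hVm hVδ
    dom_left := fun ε hε => exists_exp_sub_le (hU.const_mul (half_pos hδ)) hUδ' hUδc hε
    dom_right := fun ε hε => exists_exp_sub_le (hV.const_mul (half_pos hδ)) hVδ' hVδc hε
    bdd_sublevel := fun r => by
      -- Sub-level sets of the weights lie in sub-level sets of `U` and `V`, so their product lies
      -- in a compact set on which `W` is bounded.
      obtain ⟨C, hC⟩ := hW _ ((hUc (2 / δ * Real.log r)).prod (hVc (2 / δ * Real.log r)))
      exact ⟨C, fun x y hx hy =>
        (le_abs_self _).trans (hC (x, y) ⟨hsub r _ hx, hsub r _ hy⟩)⟩ }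

theorem integrable_of_integrable_exp {E : Type*} [MeasurableSpace E] {m : Measure E}
    [IsFiniteMeasure m] {V : E → ℝ} (hVm : Measurable V) {v s : ℝ} (hs : 0 < s)
    (hv : ∀ y, v ≤ V y) (h : Integrable (fun y => Real.exp (s * V y)) m) : Integrable V m := by
  refine ((integrable_const |v|).add (h.const_mul s⁻¹)).mono' hVm.aestronglyMeasurable ?_
  filter_upwards with y
  have h1 : V y ≤ s⁻¹ * Real.exp (s * V y) := by
    rw [inv_mul_eq_div, le_div_iff₀ hs]
    linarith [Real.add_one_le_exp (s * V y)]
  have h2 : 0 < s⁻¹ * Real.exp (s * V y) := mul_pos (inv_pos.2 hs) (Real.exp_pos _)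
  simp only [Pi.add_apply]
  rw [Real.norm_eq_abs, abs_le]
  constructor <;> linarith [hv y, neg_abs_le v, abs_nonneg v]

end Topological

end Sinkhorn

theorem theorem2p2
    {X Y : Type*}
    [TopologicalSpace X] [PolishSpace X] [LocallyCompactSpace X] [MeasurableSpace X] [BorelSpace X]
    [Nonempty X]
    [TopologicalSpace Y] [PolishSpace Y] [LocallyCompactSpace Y] [MeasurableSpace Y] [BorelSpace Y]
    [Nonempty Y]
    (lam : Measure X) [IsLocallyFiniteMeasure lam] (nu : Measure Y) [IsLocallyFiniteMeasure nu]
    (U : X → ℝ) (V : Y → ℝ) (W : X → Y → ℝ)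
    (hUm : Measurable U) (hVm : Measurable V) (hWm : Measurable (Function.uncurry W))
    [IsProbabilityMeasure (Sinkhorn.gibbs lam U)] [IsProbabilityMeasure (Sinkhorn.gibbs nu V)]
    [IsMarkovKernel (Sinkhorn.refKernel W nu)]
    -- `W` is locally bounded and bounded below
    (hW : Sinkhorn.LocallyBdd (Function.uncurry W)) (hWbelow : ∃ w : ℝ, ∀ x y, w ≤ W x y)
    -- `U, V` are locally bounded with compact sub-level sets
    (hU : Sinkhorn.LocallyBdd U) (hUc : Sinkhorn.CompactSublevels U)
    (hV : Sinkhorn.LocallyBdd V) (hVc : Sinkhorn.CompactSublevels V)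
    -- the integrated costs `W^V` and `W_U` are finite functions
    (hWV : ∀ x, Integrable (fun y => W x y) (Sinkhorn.gibbs nu V))
    (hWU : ∀ y, Integrable (fun x => W x y) (Sinkhorn.gibbs lam U))
    (δ : ℝ) (hδ : δ ∈ Ioo (0 : ℝ) 1)
    -- `𝒰_{δ/2}` and `𝒱_{δ/2}` are locally bounded with compact sub-level sets
    (h𝒰 : Sinkhorn.LocallyBdd
      fun x => δ / 2 * U x - Sinkhorn.costX W (Sinkhorn.gibbs nu V) x)
    (h𝒰c : Sinkhorn.CompactSublevels
      fun x => δ / 2 * U x - Sinkhorn.costX W (Sinkhorn.gibbs nu V) x)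
    (h𝒱 : Sinkhorn.LocallyBdd
      fun y => δ / 2 * V y - Sinkhorn.costY W (Sinkhorn.gibbs lam U) y)
    (h𝒱c : Sinkhorn.CompactSublevels
      fun y => δ / 2 * V y - Sinkhorn.costY W (Sinkhorn.gibbs lam U) y)
    -- `λ_{(1-δ)U}(1)` and `ν_{(1-δ)V}(1)` are finite
    (hUδ : Sinkhorn.gibbs lam (fun x => (1 - δ) * U x) univ < ∞)
    (hVδ : Sinkhorn.gibbs nu (fun y => (1 - δ) * V y) univ < ∞) :
    let mu : Measure X := Sinkhorn.gibbs lam U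
    let eta : Measure Y := Sinkhorn.gibbs nu V
    let Q : Kernel X Y := Sinkhorn.refKernel W nu
    let φ : X → ℝ := fun x => Real.exp (δ / 2 * U x)
    let ψ : Y → ℝ := fun y => Real.exp (δ / 2 * V y)
    ∃ ρ ∈ Ioo (0 : ℝ) 1, ∃ n₀ : ℕ, 1 ≤ n₀ ∧ ∃ c : ℝ, 0 < c ∧
      -- the marginals `π_{2n}` and `ν_V`
      (∀ n ≥ n₀,
        Sinkhorn.weightedDist ψ (Sinkhorn.evenMarginal mu eta Q n) eta
            ≤ ENNReal.ofReal (c * ρ ^ n) ∧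
        Sinkhorn.evenMarginal mu eta Q n ≪ eta ∧ eta ≪ Sinkhorn.evenMarginal mu eta Q n ∧
        Sinkhorn.weightedSupNorm eta ψ (llr (Sinkhorn.evenMarginal mu eta Q n) eta)
            ≤ ENNReal.ofReal (c * ρ ^ n) ∧
        Sinkhorn.tvDist (Sinkhorn.evenMarginal mu eta Q n) eta ≤ ENNReal.ofReal (c * ρ ^ n) ∧
        ∀ dist : Y → Y → ℝ, Sinkhorn.IsSemiMetric dist → Measurable (Function.uncurry dist) →
          (∀ y₁ y₂, dist y₁ y₂ ≤ ψ y₁ + ψ y₂) →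
          Sinkhorn.wasserstein dist (Sinkhorn.evenMarginal mu eta Q n) eta
            ≤ ENNReal.ofReal (c * ρ ^ n)) ∧
      -- the marginals `π_{2n+1}` and `λ_U`
      (∀ n ≥ n₀,
        Sinkhorn.weightedDist φ (Sinkhorn.oddMarginal mu eta Q n) mu
            ≤ ENNReal.ofReal (c * ρ ^ n) ∧
        Sinkhorn.oddMarginal mu eta Q n ≪ mu ∧ mu ≪ Sinkhorn.oddMarginal mu eta Q n ∧
        Sinkhorn.weightedSupNorm mu φ (llr (Sinkhorn.oddMarginal mu eta Q n) mu)
            ≤ ENNReal.ofReal (c * ρ ^ n) ∧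
        Sinkhorn.tvDist (Sinkhorn.oddMarginal mu eta Q n) mu ≤ ENNReal.ofReal (c * ρ ^ n) ∧
        ∀ dist : X → X → ℝ, Sinkhorn.IsSemiMetric dist → Measurable (Function.uncurry dist) →
          (∀ x₁ x₂, dist x₁ x₂ ≤ φ x₁ + φ x₂) →
          Sinkhorn.wasserstein dist (Sinkhorn.oddMarginal mu eta Q n) mu
            ≤ ENNReal.ofReal (c * ρ ^ n)) ∧
      -- the Schrödinger bridge exists, is unique, and is approached in relative entropy
      ∃ P : Measure (X × Y),
        Sinkhorn.IsSchrodingerBridge mu eta (mu ⊗ₘ Q) P ∧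
        (∀ P', Sinkhorn.IsSchrodingerBridge mu eta (mu ⊗ₘ Q) P' → P' = P) ∧
        ∀ n : ℕ, InformationTheory.klDiv P (Sinkhorn.evenBridge mu eta Q n)
            ≤ ENNReal.ofReal (c * ρ ^ n) := by
  have H := Sinkhorn.admissible_gibbs hUm hVm hWm hW hWbelow hU hUc hV hVc hWV hWU hδ.1 h𝒰 h𝒰c
    h𝒱 h𝒱c hUδ hVδ
  obtain ⟨v, hv⟩ := Sinkhorn.exists_le_of_compactSublevels hV hVc
  -- Integrability of `V` makes the initial log integral `∫ log b_0 dη = ∫ V dη` finite, the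
  -- starting value of the monotone sequence.
  have hVi := Sinkhorn.integrable_of_integrable_exp hVm (half_pos hδ.1) hv H.integrable_psi
  exact H.sinkhorn_convergence (Sinkhorn.normalized_gibbs hWm hVm hVi)
    (Sinkhorn.compProd_refKernel hWm hVm)
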